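/- Let $R$ be a commutative ring with group of units $R^\times$ and let $G$ be a group. Let $\mathcal R[G]$ be the category of $G$-graded free $R$-modules of finite total dimension and grading-preserving $R$-homomorphisms, with the standard product $(X\otimes Y)_f=\bigoplus_{gh=f}X_g\otimes Y_h$. All cochains are cellular with values in $R^\times$ (written multiplicatively). The bar construction $B_G$ has as $n$-cells the $n$-tuples in $G$, with boundary $\partial=\sum_{i=0}^n(-1)^i\partial_i$, where $\partial_0$ and $\partial_n$ omit the first and the last entry and $\partial_i$ multiplies the entries $i$ and $i+1$ for $0<i<n$. If $G$ is abelian, then $B_G$ has a product given by shuffles and one forms $B^2_G=B(B_G)$, with cells $\Delta^n\times(x_1\times\cdots\times x_n)$ for $x_i$ cells of $B_G$, and similarly $B^3_G=B(B^2_G)$; cochains on $B^2_G$ and $B^3_G$ are taken on the quotient of the cellular chain complex by the (contractible) subcomplex spanned by the cells having a $0$-cell of $B_G$ (or, for $B^3_G$, a $0$-cell of $B_G$ or $B^2_G$) as a factor. "Multiplication by $\alpha(a,b,c)$" means multiplication by this unit on the summand of degrees $a,b,c$. An associativity structure is a natural isomorphism $(X\otimes Y)\otimes Z\cong X\otimes(Y\otimes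 Z)$ satisfying the pentagon axiom. A braided structure is an associativity structure together with a natural isomorphism $X\otimes Y\cong Y\otimes X$ satisfying both hexagon axioms. It is symmetric if the composite $X\otimes Y\to Y\otimes X\to X\otimes Y$ is always the identity. Every associativity structure admits natural unit isomorphisms for the unit object $R$ in degree $1$ that satisfy the triangle axiom. It thus gives a monoidal structure on $\mathcal R[G]$, and a braided or symmetric structure gives a braided or symmetric monoidal structure. Moreover: 1. Sending a $3$-cocycle $\alpha$ on $B_G$ to the standard associativity isomorphism multiplied by $\alpha(a,b,c)$ is a bijection from the $3$-cocycles on $B_G$ to the associativity structures for the standard product on $\mathcal R[G]$. Sending a $2$-cochain $\mu$ to multiplication by $\mu(a,b)$ is a bijection from the $2$-cochains to the natural automorphisms of the product functor. Coboundaries of $2$-cochains are cocycles, and $\alpha'=\alpha\cdot\delta\mu$ if and only if the identity functor together with the natural automorphism $\mu$ carries the associativity $\alpha$ to $\alpha'$, i.e. $\mu_{X,Y\otimes Z}\circ(1_X\otimes\mu_{Y,Z})\circ\alpha_{X,Y,Z}=\alpha'_{X,Y,Z}\circ\mu_{X\otimes Y,Z}\circ(\mu_{X,Y}\otimes 1_Z)$.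 2. Suppose $G$ is abelian. A $4$-cochain on $B^2_G$ is a pair $(\alpha,\sigma)$, with $\alpha(a,b,c)$ its value on the cell $\Delta^1\times\Delta^3$ indexed by $(a,b,c)$ and $\sigma(a,b)$ its value on the cell $\Delta^2\times(\Delta^1\times\Delta^1)$ indexed by $((a),(b))$. Sending $(\alpha,\sigma)$ to the standard associativity isomorphism multiplied by $\alpha(a,b,c)$ and the standard commutativity isomorphism multiplied by $\sigma(a,b)^{-1}$ is a bijection from the $4$-cocycles on $B^2_G$ to the braided structures for the standard product on $\mathcal R[G]$. A $3$-cochain on $B^2_G$ is a function $\mu(a,b)$ (its values on the cells $\Delta^1\times\Delta^2$). Sending it to multiplication by $\mu(a,b)^{-1}$ is a bijection from the $3$-cochains to the natural automorphisms of the product functor. Coboundaries of $3$-cochains are cocycles, and $(\alpha',\sigma')=(\alpha,\sigma)\cdot\delta\mu$ if and only if the identity functor together with this natural automorphism carries the associativity and commutativity isomorphisms of $(\alpha,\sigma)$ to those of $(\alpha',\sigma')$. 3. Suppose $G$ is abelian. A $5$-cochain on $B^3_G$ is again a pair $(\alpha,\sigma)$ (its values on the products of $\Delta^1$ with the two kinds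 of $4$-cells of $B^2_G$ above). The same assignment as in 2 is a bijection from the $5$-cocycles on $B^3_G$ to the symmetric structures for the standard product on $\mathcal R[G]$. -/

import Mathlib

open CategoryTheory TensorProduct

universe u v

namespace GroupCat

noncomputable section

/-! ### Cellular chains of bar constructions -/

/-- The cellular data of a cell complex with a cellular multiplication: `S` is the set of (oriented)
cells, `dim` is the dimension of a cell, `bd` is the cellular boundary (in the free abelian group on
the cells), and `mul x y` is the cellular chain that is the image of the product cell `x × y` under
the multiplication. -/
structure CellData (S : Type v) where
  dim : S → ℕ
  bd : S → (S →₀ ℤ)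
  mul : S → S → (S →₀ ℤ)

namespace CellData

variable {S : Type v} (A : CellData S)

/-- Dimension of the product cell `x₁ × ⋯ × xₙ`. -/
def tupleDim (l : List S) : ℕ := (l.map A.dim).sum

/-- Boundary of the product cell `x₁ × ⋯ × xₙ`, by the rule
`∂(x × y) = ∂x × y + (-1)^(dim x) x × ∂y`. -/
def tupleBd : List S → (List S →₀ ℤ)
  | [] => 0
  | x :: l => (A.bd x).mapDomain (fun y => y :: l)
      + (-1 : ℤ) ^ A.dim x • (tupleBd l).mapDomain (fun m => x :: m)

/-- `face k l` is the cellular chain of the image of `∂ₖΔⁿ × x₁ × ⋯ × xₙ`, where `l = [x₁, …, xₙ]`: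
the zeroth face omits `x₁`, the `n`-th face omits `xₙ`, and for `0 < k < n` the entries `xₖ` and
`xₖ₊₁` are multiplied. Omitting an entry of positive dimension lowers the dimension of the image,
so that it contributes `0`. -/
def face : ℕ → List S → (List S →₀ ℤ)
  | _, [] => 0
  | 0, x :: l => if A.dim x = 0 then Finsupp.single l 1 else 0
  | 1, [x] => if A.dim x = 0 then Finsupp.single [] 1 else 0
  | 1, x :: y :: l => (A.mul x y).mapDomain (fun z => z :: l)
  | k + 2, x :: l => (face (k + 1) l).mapDomain (fun m => x :: m)

/-- Boundary of the cell `Δⁿ × (x₁ × ⋯ × xₙ)` of the bar construction. -/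
def barBd (l : List S) : List S →₀ ℤ :=
  (∑ k ∈ Finset.range (l.length + 1), (-1 : ℤ) ^ k • A.face k l)
    + (-1 : ℤ) ^ l.length • A.tupleBd l

/-- The sum over all shuffles of the two lists. The sign of a shuffle is its parity as a permutation
(the orientation of the simplex in `Δⁱ × Δʲ`), times the sign for permuting the product cells: moving
`y` in front of `x₁, …, xᵢ` gives `(-1)^i * (-1)^(dim y * (dim x₁ + ⋯ + dim xᵢ))`. -/
def shuffle : List S → List S → (List S →₀ ℤ)
  | [], l => Finsupp.single l 1
  | x :: l, [] => Finsupp.single (x :: l) 1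
  | x :: l, y :: m =>
      (shuffle l (y :: m)).mapDomain (fun t => x :: t)
        + (-1 : ℤ) ^ ((x :: l).length + A.dim y * A.tupleDim (x :: l)) •
          (shuffle (x :: l) m).mapDomain (fun t => y :: t)
  termination_by l m => l.length + m.length

/-- The product of the cells `Δⁱ × X` and `Δʲ × Y`, where `X = x₁ × ⋯ × xᵢ` and `Y = y₁ × ⋯ × yⱼ`:
`Δⁱ × Δʲ` is subdivided by shuffles; the sign `(-1)^(j * dim X)` interchanges `X` and `Δʲ`. -/
def barMul (l m : List S) : List S →₀ ℤ :=
  (-1 : ℤ) ^ (m.length * A.tupleDim l) • A.shuffle l m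

/-- The bar construction: its cells are `Δⁿ × (x₁ × ⋯ × xₙ)`, indexed by `[x₁, …, xₙ]`. -/
def bar : CellData (List S) where
  dim l := l.length + A.tupleDim l
  bd := A.barBd
  mul := A.barMul

/-- The `n`-cells that satisfy `P` (the "nontrivial" ones). -/
abbrev NCell (P : S → Prop) (n : ℕ) : Type v := {x : S // P x ∧ A.dim x = n}

/-- Cellular `n`-cochains with values in the (multiplicative) abelian group `H`, on the quotient of
the cellular chain complex by the span of the cells that do not satisfy `P`. -/
abbrev Cochain (P : S → Prop) (H : Type u) (n : ℕ) : Type (max u v) := A.NCell P n → H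

open Classical in
/-- The value of an `n`-cochain on a cell, trivial on the cells that are divided out
and on cells of other dimensions. -/
def Cochain.onCell {A : CellData S} {P : S → Prop} {H : Type u} [CommGroup H] {n : ℕ}
    (f : A.Cochain P H n) (x : S) : H :=
  if h : P x ∧ A.dim x = n then f ⟨x, h⟩ else 1

/-- The coboundary `δf = f ∘ ∂`, written multiplicatively. -/
def coboundary (P : S → Prop) (H : Type u) [CommGroup H] (n : ℕ) :
    A.Cochain P H n →* A.Cochain P H (n + 1) where
  toFun f x := (A.bd x.1).prod fun y k => f.onCell y ^ k
  map_one' := by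
    funext x
    have h : ∀ y, Cochain.onCell (1 : A.Cochain P H n) y = 1 := by
      intro y
      unfold Cochain.onCell
      split_ifs <;> rfl
    simp [h, Finsupp.prod]
  map_mul' f g := by
    funext x
    have h : ∀ y, Cochain.onCell (f * g) y = f.onCell y * g.onCell y := by
      intro y
      unfold Cochain.onCell
      split_ifs <;> simp
    simp [h, mul_zpow, Finsupp.prod, Finset.prod_mul_distrib]

/-- Cellular `n`-cocycles. -/
def cocycles (P : S → Prop) (H : Type u) [CommGroup H] (n : ℕ) : Subgroup (A.Cochain P H n) :=
  (A.coboundary P H n).ker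

/-- Cellular `(n+1)`-coboundaries. -/
def coboundaries (P : S → Prop) (H : Type u) [CommGroup H] (n : ℕ) :
    Subgroup (A.Cochain P H (n + 1)) :=
  (A.coboundary P H n).range

end CellData

/-- A discrete group as a cell complex with multiplication. -/
def discrete (G : Type v) [Group G] : CellData G where
  dim _ := 0
  bd _ := 0
  mul a b := Finsupp.single (a * b) 1

/-- The bar construction `B_G`; its `n`-cells are the `n`-tuples of elements of `G`. -/
def B1 (G : Type v) [Group G] : CellData (List G) := (discrete G).bar

/-- The iterated bar construction `B²_G = B(B_G)` (for `G` abelian). -/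
def B2 (G : Type v) [Group G] : CellData (List (List G)) := (B1 G).bar

/-- The iterated bar construction `B³_G = B(B²_G)` (for `G` abelian). -/
def B3 (G : Type v) [Group G] : CellData (List (List (List G))) := (B2 G).bar

/-- No cell of `B_G` is divided out. -/
def Nontriv1 {G : Type v} (_ : List G) : Prop := True

/-- The cells of `B²_G` that do not involve the 0-cell of `B_G`. -/
def Nontriv2 {G : Type v} (L : List (List G)) : Prop := ∀ x ∈ L, x ≠ []

/-- The cells of `B³_G` that involve neither the 0-cell of `B²_G` nor the 0-cell of `B_G`. -/
def Nontriv3 {G : Type v} (L : List (List (List G))) : Prop := ∀ X ∈ L, X ≠ [] ∧ Nontriv2 X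

/-- The 2-cell `(a,b)` of `B_G`. -/
def cell1_2 {G : Type v} [Group G] (a b : G) : (B1 G).NCell Nontriv1 2 :=
  ⟨[a, b], trivial, rfl⟩

/-- The 3-cell `(a,b,c)` of `B_G`. -/
def cell1_3 {G : Type v} [Group G] (a b c : G) : (B1 G).NCell Nontriv1 3 :=
  ⟨[a, b, c], trivial, rfl⟩

/-- The 3-cell `Δ¹ × Δ²` of `B²_G` indexed by `(a,b)`. -/
def cell2_2 {G : Type v} [Group G] (a b : G) : (B2 G).NCell Nontriv2 3 :=
  ⟨[[a, b]], by simp [Nontriv2], rfl⟩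

/-- The 4-cell `Δ¹ × Δ³` of `B²_G` indexed by `(a,b,c)`. -/
def cell2_3 {G : Type v} [Group G] (a b c : G) : (B2 G).NCell Nontriv2 4 :=
  ⟨[[a, b, c]], by simp [Nontriv2], rfl⟩

/-- The 4-cell `Δ² × (Δ¹ × Δ¹)` of `B²_G` indexed by `((a),(b))`. -/
def cell2_11 {G : Type v} [Group G] (a b : G) : (B2 G).NCell Nontriv2 4 :=
  ⟨[[a], [b]], by simp [Nontriv2], rfl⟩

/-- The 5-cell of `B³_G` that is `Δ¹` times the 4-cell `(a,b,c)` of `B²_G`. -/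
def cell3_3 {G : Type v} [Group G] (a b c : G) : (B3 G).NCell Nontriv3 5 :=
  ⟨[[[a, b, c]]], by simp [Nontriv3, Nontriv2], rfl⟩

/-- The 5-cell of `B³_G` that is `Δ¹` times the 4-cell `((a),(b))` of `B²_G`. -/
def cell3_11 {G : Type v} [Group G] (a b : G) : (B3 G).NCell Nontriv3 5 :=
  ⟨[[[a], [b]]], by simp [Nontriv3, Nontriv2], rfl⟩

/-! ### The category `R[G]` and its standard product -/

/-- Objects of `R[G]`: `G`-graded free `R`-modules of finite total dimension. The module is the
internal direct sum of its homogeneous pieces, each of which is free. -/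
structure Obj (R : Type u) [CommRing R] (G : Type v) where
  carrier : Type u
  [addCommGroup : AddCommGroup carrier]
  [module : Module R carrier]
  piece : G → Submodule R carrier
  indep : iSupIndep piece
  span : ⨆ g, piece g = ⊤
  finite : Module.Finite R carrier
  free : ∀ g, Module.Free R (piece g)

attribute [instance] Obj.addCommGroup Obj.module Obj.finite Obj.free

variable {R : Type u} [CommRing R] {G : Type v}

/-- Morphisms of `R[G]`: `R`-linear maps that preserve the grading. -/
@[ext]
structure Hom (X Y : Obj R G) where
  toLin : X.carrier →ₗ[R] Y.carrier
  map_mem : ∀ g, ∀ x ∈ X.piece g, toLin x ∈ Y.piece g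

instance : Category (Obj R G) where
  Hom X Y := Hom X Y
  id X := ⟨LinearMap.id, fun _ _ hx => hx⟩
  comp f g := ⟨g.toLin ∘ₗ f.toLin, fun a x hx => g.map_mem a _ (f.map_mem a x hx)⟩

/-- The linear map underlying a morphism. -/
def lin {X Y : Obj R G} (f : X ⟶ Y) : X.carrier →ₗ[R] Y.carrier := Hom.toLin f

theorem hom_ext {X Y : Obj R G} {f g : X ⟶ Y} (h : lin f = lin g) : f = g := Hom.ext h

section Basis

variable {M : Type u} [AddCommGroup M] [Module R M] {ι : Type*}

theorem basis_indep (b : Module.Basis ι R M) (deg : ι → G) :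
    iSupIndep (fun g => Submodule.span R (b '' {i | deg i = g})) := by
  intro g
  have h : (⨆ j, ⨆ (_ : j ≠ g), Submodule.span R (b '' {i | deg i = j}))
      ≤ Submodule.span R (b '' {i | deg i ≠ g}) := by
    refine iSup₂_le fun j hj => Submodule.span_mono (Set.image_mono ?_)
    rintro i rfl
    exact hj
  refine Disjoint.mono_right h (b.linearIndependent.disjoint_span_image ?_)
  rw [Set.disjoint_left]
  intro i hi hi'
  exact hi' hi

theorem basis_span (b : Module.Basis ι R M) (deg : ι → G) :
    ⨆ g, Submodule.span R (b '' {i | deg i = g}) = ⊤ := by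
  rw [eq_top_iff, ← b.span_eq, Submodule.span_le]
  rintro _ ⟨i, rfl⟩
  exact Submodule.mem_iSup_of_mem (deg i) (Submodule.subset_span ⟨i, rfl, rfl⟩)

theorem basis_free (b : Module.Basis ι R M) (s : Set ι) :
    Module.Free R (Submodule.span R (b '' s)) := by
  have h : LinearIndependent R (fun i : s => b i) :=
    b.linearIndependent.comp _ Subtype.val_injective
  have e : b '' s = Set.range (fun i : s => b i) := by
    ext x; simp
  rw [e]
  exact Module.Free.of_basis (Module.Basis.span h)

end Basis

/-- An object of `R[G]` has a basis of homogeneous elements. -/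
theorem exists_homogeneous_basis (X : Obj R G) :
    ∃ (ι : Type (max u v)) (b : Module.Basis ι R X.carrier) (deg : ι → G),
      ∀ g, X.piece g = Submodule.span R (b '' {i | deg i = g}) := by
  classical
  have hi : DirectSum.IsInternal X.piece :=
    (DirectSum.isInternal_submodule_iff_iSupIndep_and_iSup_eq_top _).2 ⟨X.indep, X.span⟩
  let v := fun g => Module.Free.chooseBasis R (X.piece g)
  refine ⟨_, hi.collectedBasis v, Sigma.fst, fun g => le_antisymm ?_ ?_⟩
  · have h : (⊤ : Submodule R (X.piece g)) = Submodule.span R (Set.range (v g)) :=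
      (v g).span_eq.symm
    have h2 : X.piece g = Submodule.map (X.piece g).subtype ⊤ := by simp
    rw [h2, h, Submodule.map_span, Submodule.span_le]
    rintro _ ⟨_, ⟨i, rfl⟩, rfl⟩
    exact Submodule.subset_span ⟨⟨g, i⟩, rfl, by simp⟩
  · rw [Submodule.span_le]
    rintro _ ⟨⟨g', i⟩, rfl, rfl⟩
    exact hi.collectedBasis_mem v _

variable [Group G]

/-- The standard product of gradings: `(a ⊗ b)_f` is the (direct) sum of the `a_g ⊗ b_h`
over all `g h` with `g * h = f`. -/
def tensorPiece (X Y : Obj R G) (f : G) : Submodule R (X.carrier ⊗[R] Y.carrier) :=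
  Submodule.span R {t | ∃ g h, g * h = f ∧ ∃ x ∈ X.piece g, ∃ y ∈ Y.piece h, t = x ⊗ₜ[R] y}

theorem tmul_mem_tensorPiece {X Y : Obj R G} {g h : G} {x : X.carrier} {y : Y.carrier}
    (hx : x ∈ X.piece g) (hy : y ∈ Y.piece h) : x ⊗ₜ[R] y ∈ tensorPiece X Y (g * h) :=
  Submodule.subset_span ⟨g, h, rfl, x, hx, y, hy, rfl⟩

theorem exists_tensor_basis (X Y : Obj R G) :
    ∃ (ι : Type (max u v)) (b : Module.Basis ι R (X.carrier ⊗[R] Y.carrier)) (deg : ι → G),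
      ∀ f, tensorPiece X Y f = Submodule.span R (b '' {i | deg i = f}) := by
  obtain ⟨ι, b, d, hb⟩ := exists_homogeneous_basis X
  obtain ⟨κ, c, e, hc⟩ := exists_homogeneous_basis Y
  refine ⟨ι × κ, b.tensorProduct c, fun p => d p.1 * e p.2, fun f => le_antisymm ?_ ?_⟩
  · refine Submodule.span_le.2 ?_
    rintro _ ⟨g, h, rfl, x, hx, y, hy, rfl⟩
    rw [hb] at hx
    rw [hc] at hy
    have hxy := Submodule.apply_mem_map₂ (TensorProduct.mk R X.carrier Y.carrier) hx hy
    rw [Submodule.map₂_span_span] at hxy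
    refine Submodule.span_mono ?_ hxy
    rintro _ ⟨_, ⟨i, rfl, rfl⟩, _, ⟨j, rfl, rfl⟩, rfl⟩
    exact ⟨(i, j), rfl, by simp⟩
  · refine Submodule.span_le.2 ?_
    rintro _ ⟨⟨i, j⟩, rfl, rfl⟩
    refine Submodule.subset_span ⟨d i, e j, rfl, b i, ?_, c j, ?_, by simp⟩
    · rw [hb]; exact Submodule.subset_span ⟨i, rfl, rfl⟩
    · rw [hc]; exact Submodule.subset_span ⟨j, rfl, rfl⟩

/-- The standard product of objects of `R[G]`. -/
def tObj (X Y : Obj R G) : Obj R G where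
  carrier := X.carrier ⊗[R] Y.carrier
  piece := tensorPiece X Y
  indep := by
    obtain ⟨ι, b, d, h⟩ := exists_tensor_basis X Y
    rw [show tensorPiece X Y = _ from funext h]
    exact basis_indep b d
  span := by
    obtain ⟨ι, b, d, h⟩ := exists_tensor_basis X Y
    rw [show tensorPiece X Y = _ from funext h]
    exact basis_span b d
  finite := inferInstance
  free f := by
    obtain ⟨ι, b, d, h⟩ := exists_tensor_basis X Y
    rw [h]
    exact basis_free b _

/-- The homogeneous tensor `x ⊗ y` as an element of the product object. -/
def tmk {X Y : Obj R G} (x : X.carrier) (y : Y.carrier) : (tObj X Y).carrier := x ⊗ₜ[R] y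

/-- The standard product of morphisms of `R[G]`. -/
def tHom {X X' Y Y' : Obj R G} (f : X ⟶ X') (g : Y ⟶ Y') : tObj X Y ⟶ tObj X' Y' :=
  Hom.mk (X := tObj X Y) (Y := tObj X' Y') (TensorProduct.map (lin f) (lin g)) (by
    intro a
    change tensorPiece X Y a ≤ (tensorPiece X' Y' a).comap (TensorProduct.map (lin f) (lin g))
    refine Submodule.span_le.2 ?_
    rintro _ ⟨g', h', rfl, x, hx, y, hy, rfl⟩
    exact tmul_mem_tensorPiece (Hom.map_mem f _ _ hx) (Hom.map_mem g _ _ hy))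

theorem tHom_id (X Y : Obj R G) : tHom (𝟙 X) (𝟙 Y) = 𝟙 (tObj X Y) :=
  hom_ext TensorProduct.map_id

theorem tHom_comp {X X' X'' Y Y' Y'' : Obj R G} (f : X ⟶ X') (f' : X' ⟶ X'')
    (g : Y ⟶ Y') (g' : Y' ⟶ Y'') : tHom (f ≫ f') (g ≫ g') = tHom f g ≫ tHom f' g' :=
  hom_ext (TensorProduct.map_comp _ _ _ _)

/-- The simple object at `g`: a copy of `R` in degree `g` and zero in all other degrees. -/
def simple (R : Type u) [CommRing R] (g : G) : Obj R G where
  carrier := R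
  piece h := ⨆ (_ : h = g), ⊤
  indep := by
    intro h
    by_cases hh : h = g
    · subst hh
      refine disjoint_bot_right.mono_right (iSup₂_le fun j hj => ?_)
      simp [hj]
    · simp [hh]
  span := by
    rw [eq_top_iff]
    exact le_iSup_of_le g (by simp)
  finite := inferInstance
  free h := by
    by_cases hh : h = g
    · rw [iSup_pos hh]; exact Module.Free.of_equiv Submodule.topEquiv.symm
    · rw [iSup_neg hh]; infer_instance

/-! ### Associativity, commutativity and unit structures for the standard product -/

/-- A natural associativity isomorphism for the standard product on `R[G]`: a natural isomorphism
`(X ⊗ Y) ⊗ Z ≅ X ⊗ (Y ⊗ Z)` that satisfies the pentagon axiom. -/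
structure AssocStr (R : Type u) [CommRing R] (G : Type v) [Group G] where
  iso : ∀ X Y Z : Obj R G, tObj (tObj X Y) Z ≅ tObj X (tObj Y Z)
  natural : ∀ {X X' Y Y' Z Z' : Obj R G} (f : X ⟶ X') (g : Y ⟶ Y') (h : Z ⟶ Z'),
    tHom (tHom f g) h ≫ (iso X' Y' Z').hom = (iso X Y Z).hom ≫ tHom f (tHom g h)
  pentagon : ∀ W X Y Z : Obj R G,
    tHom (iso W X Y).hom (𝟙 Z) ≫ (iso W (tObj X Y) Z).hom ≫ tHom (𝟙 W) (iso X Y Z).hom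
      = (iso (tObj W X) Y Z).hom ≫ (iso W X (tObj Y Z)).hom

/-- A braided-commutative structure for the standard product on `R[G]`: natural associativity and
commutativity isomorphisms that satisfy the pentagon axiom and both hexagon axioms. -/
structure BraidedStr (R : Type u) [CommRing R] (G : Type v) [Group G] extends AssocStr R G where
  comm : ∀ X Y : Obj R G, tObj X Y ≅ tObj Y X
  comm_natural : ∀ {X X' Y Y' : Obj R G} (f : X ⟶ X') (g : Y ⟶ Y'),
    tHom f g ≫ (comm X' Y').hom = (comm X Y).hom ≫ tHom g f
  hexagon_forward : ∀ X Y Z : Obj R G,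
    (iso X Y Z).hom ≫ (comm X (tObj Y Z)).hom ≫ (iso Y Z X).hom
      = tHom (comm X Y).hom (𝟙 Z) ≫ (iso Y X Z).hom ≫ tHom (𝟙 Y) (comm X Z).hom
  hexagon_reverse : ∀ X Y Z : Obj R G,
    (iso X Y Z).inv ≫ (comm (tObj X Y) Z).hom ≫ (iso Z X Y).inv
      = tHom (𝟙 X) (comm Y Z).hom ≫ (iso X Z Y).inv ≫ tHom (comm X Z).hom (𝟙 Y)

/-- A symmetric structure for the standard product on `R[G]`. -/
structure SymmetricStr (R : Type u) [CommRing R] (G : Type v) [Group G] extends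
    BraidedStr R G where
  symmetry : ∀ X Y : Obj R G, (comm X Y).hom ≫ (comm Y X).hom = 𝟙 (tObj X Y)

/-- Unit isomorphisms for an associativity structure, with unit the simple object at `1`. -/
structure UnitStr (A : AssocStr R G) where
  left : ∀ X : Obj R G, tObj (simple R 1) X ≅ X
  right : ∀ X : Obj R G, tObj X (simple R 1) ≅ X
  left_natural : ∀ {X Y : Obj R G} (f : X ⟶ Y),
    tHom (𝟙 (simple R 1)) f ≫ (left Y).hom = (left X).hom ≫ f
  right_natural : ∀ {X Y : Obj R G} (f : X ⟶ Y),
    tHom f (𝟙 (simple R 1)) ≫ (right Y).hom = (right X).hom ≫ f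
  triangle : ∀ X Y : Obj R G,
    (A.iso X (simple R 1) Y).hom ≫ tHom (𝟙 X) (left Y).hom = tHom (right X).hom (𝟙 Y)

/-- An associativity structure with unit isomorphisms is a monoidal structure on `R[G]`. -/
@[reducible]
def UnitStr.monoidal {A : AssocStr R G} (U : UnitStr A) : MonoidalCategory (Obj R G) where
  tensorObj := tObj
  whiskerLeft X _ _ f := tHom (𝟙 X) f
  whiskerRight f Y := tHom f (𝟙 Y)
  tensorHom := tHom
  tensorUnit := simple R 1
  associator := A.iso
  leftUnitor := U.left
  rightUnitor := U.right
  tensorHom_def f g := by rw [← tHom_comp]; simp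
  id_tensorHom_id := tHom_id
  tensorHom_comp_tensorHom f₁ f₂ g₁ g₂ := (tHom_comp f₁ g₁ f₂ g₂).symm
  whiskerLeft_id := tHom_id
  id_whiskerRight := tHom_id
  associator_naturality := A.natural
  leftUnitor_naturality := U.left_natural
  rightUnitor_naturality := U.right_natural
  pentagon := A.pentagon
  triangle := U.triangle

/-- A braided-commutative structure with unit isomorphisms is a braided monoidal structure. -/
@[reducible]
def UnitStr.braided (B : BraidedStr R G) (U : UnitStr B.toAssocStr) :
    @BraidedCategory (Obj R G) _ U.monoidal :=
  letI := U.monoidal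
  { braiding := B.comm
    braiding_naturality_right := fun X _ _ f => B.comm_natural (𝟙 X) f
    braiding_naturality_left := fun f Z => B.comm_natural f (𝟙 Z)
    hexagon_forward := B.hexagon_forward
    hexagon_reverse := B.hexagon_reverse }

/-- A symmetric structure with unit isomorphisms is a symmetric monoidal structure. -/
@[reducible]
def UnitStr.symmetric (B : SymmetricStr R G) (U : UnitStr B.toAssocStr) :
    @SymmetricCategory (Obj R G) _ U.monoidal :=
  letI := U.monoidal
  letI := UnitStr.braided B.toBraidedStr U
  { symmetry := B.symmetry }

/-- A natural (invertible) transformation of the standard product functor to itself. -/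
structure ProductAut (R : Type u) [CommRing R] (G : Type v) [Group G] where
  iso : ∀ X Y : Obj R G, tObj X Y ≅ tObj X Y
  natural : ∀ {X X' Y Y' : Obj R G} (f : X ⟶ X') (g : Y ⟶ Y'),
    tHom f g ≫ (iso X' Y').hom = (iso X Y).hom ≫ tHom f g

/-- `A'` is obtained from `A` by composition with the self-transformation `T` of the product:
the identity functor together with `T` commutes with the associativity isomorphisms. -/
def ProductAut.CarriesAssoc (T : ProductAut R G) (A A' : AssocStr R G) : Prop :=
  ∀ X Y Z : Obj R G,
    (A.iso X Y Z).hom ≫ tHom (𝟙 X) (T.iso Y Z).hom ≫ (T.iso X (tObj Y Z)).hom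
      = tHom (T.iso X Y).hom (𝟙 Z) ≫ (T.iso (tObj X Y) Z).hom ≫ (A'.iso X Y Z).hom

/-- The identity functor together with `T` commutes with the associativity and the commutativity
isomorphisms of `B` and `B'`. -/
def ProductAut.CarriesBraided (T : ProductAut R G) (B B' : BraidedStr R G) : Prop :=
  T.CarriesAssoc B.toAssocStr B'.toAssocStr ∧
    ∀ X Y : Obj R G,
      (B.comm X Y).hom ≫ (T.iso Y X).hom = (T.iso X Y).hom ≫ (B'.comm X Y).hom

/-- The associativity isomorphism of `A` is the standard one multiplied by `α(a,b,c)` in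
degrees `a, b, c`. -/
def AssocStr.HasScalars (A : AssocStr R G) (α : G → G → G → Rˣ) : Prop :=
  ∀ (X Y Z : Obj R G) (a b c : G), ∀ x ∈ X.piece a, ∀ y ∈ Y.piece b, ∀ z ∈ Z.piece c,
    lin (A.iso X Y Z).hom (tmk (tmk x y) z) = (α a b c : R) • tmk x (tmk y z)

/-- The commutativity isomorphism of `B` is the standard one multiplied by `τ(a,b)` in
degrees `a, b`. -/
def BraidedStr.CommHasScalars (B : BraidedStr R G) (τ : G → G → Rˣ) : Prop :=
  ∀ (X Y : Obj R G) (a b : G), ∀ x ∈ X.piece a, ∀ y ∈ Y.piece b,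
    lin (B.comm X Y).hom (tmk x y) = (τ a b : R) • tmk y x

/-- The self-transformation `T` of the product is multiplication by `μ(a,b)` in degrees `a, b`. -/
def ProductAut.HasScalars (T : ProductAut R G) (μ : G → G → Rˣ) : Prop :=
  ∀ (X Y : Obj R G) (a b : G), ∀ x ∈ X.piece a, ∀ y ∈ Y.piece b,
    lin (T.iso X Y).hom (tmk x y) = (μ a b : R) • tmk x y

end

end GroupCat

/-!
Every object of `R[G]` is a direct sum of simple ones, and an endomorphism of a product of simple
objects is a scalar. A natural isomorphism between iterated products is therefore multiplication by
a unit for each tuple of degrees, and an axiom holds exactly when these units satisfy the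
corresponding identity. The pentagon at degrees `a, b, c, d` is the cocycle condition on the cell
`[a, b, c, d]`. For the commutativity, the hexagon axioms are the conditions on the cells
`[[a], [b, c]]` and `[[a, b], [c]]`, because the second hexagon is the first one for the inverse
braiding, and symmetry is the condition on the cell `[[[a]], [[b]]]` of `B³_G`. The pentagon with
`b = c = 1` gives `α(a, 1, d) = α(a, 1, 1) α(1, 1, d)`, so the standard unit isomorphisms multiplied
by `α(1, 1, d)⁻¹` on the left and by `α(a, 1, 1)` on the right satisfy the triangle axiom.
-/

namespace GroupCat

noncomputable section

section GradedModules

variable {R : Type u} [CommRing R] {G : Type v}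

theorem eq_of_le_of_iSupIndep {L ι : Type*} [CompleteLattice L] [IsModularLattice L] {s t : ι → L}
    (hst : s ≤ t) (ht : iSupIndep t) (hs : ⨆ i, s i = ⊤) : s = t := by
  funext i
  have hcover : s i ⊔ ⨆ (j) (_ : j ≠ i), t j = ⊤ := by
    refine top_le_iff.1 (hs.symm.le.trans (iSup_le fun j => ?_))
    by_cases hj : j = i
    · exact hj ▸ le_sup_left
    · exact le_sup_of_le_right (le_iSup₂_of_le j hj (hst j))
  calc s i = s i ⊔ (⨆ (j) (_ : j ≠ i), t j) ⊓ t i := by rw [(ht i).symm.eq_bot, sup_bot_eq]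
    _ = (s i ⊔ ⨆ (j) (_ : j ≠ i), t j) ⊓ t i := (sup_inf_assoc_of_le _ (hst i)).symm
    _ = t i := by rw [hcover, top_inf_eq]

theorem Obj.span_homogeneous (X : Obj R G) : Submodule.span R {x | ∃ a, x ∈ X.piece a} = ⊤ := by
  rw [eq_top_iff, ← X.span]
  exact iSup_le fun a x hx => Submodule.subset_span ⟨a, hx⟩

theorem Obj.exists_linearMap_eqOn_piece (X : Obj R G) {M : Type*} [AddCommGroup M] [Module R M]
    (c : G → X.carrier →ₗ[R] M) :
    ∃ L : X.carrier →ₗ[R] M, ∀ a, ∀ x ∈ X.piece a, L x = c a x := by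
  obtain ⟨ι, b, deg, h⟩ := exists_homogeneous_basis X
  refine ⟨b.constr R fun i => c (deg i) (b i), fun a x hx => ?_⟩
  rw [h] at hx
  refine LinearMap.eqOn_span (f := b.constr R fun i => c (deg i) (b i)) (g := c a) ?_ hx
  rintro _ ⟨i, rfl, rfl⟩
  exact b.constr_basis R _ i

/-- The linear map out of a graded module that agrees with `c a` on the piece of degree `a`. -/
def Obj.glue (X : Obj R G) {M : Type*} [AddCommGroup M] [Module R M]
    (c : G → X.carrier →ₗ[R] M) : X.carrier →ₗ[R] M :=
  (X.exists_linearMap_eqOn_piece c).choose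

theorem Obj.glue_apply (X : Obj R G) {M : Type*} [AddCommGroup M] [Module R M]
    (c : G → X.carrier →ₗ[R] M) {a : G} {x : X.carrier} (hx : x ∈ X.piece a) :
    X.glue c x = c a x := (X.exists_linearMap_eqOn_piece c).choose_spec a x hx

@[simp] theorem lin_comp {X Y Z : Obj R G} (f : X ⟶ Y) (g : Y ⟶ Z) (x : X.carrier) :
    lin (f ≫ g) x = lin g (lin f x) := rfl

@[simp] theorem lin_id (X : Obj R G) (x : X.carrier) : lin (𝟙 X) x = x := rfl

theorem lin_mem {X Y : Obj R G} (f : X ⟶ Y) {a : G} {x : X.carrier} (hx : x ∈ X.piece a) :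
    lin f x ∈ Y.piece a := Hom.map_mem f a x hx

theorem lin_inv_lin_hom {X Y : Obj R G} (e : X ≅ Y) (x : X.carrier) :
    lin e.inv (lin e.hom x) = x := by
  rw [← lin_comp, e.hom_inv_id, lin_id]

theorem lin_hom_lin_inv {X Y : Obj R G} (e : X ≅ Y) (y : Y.carrier) :
    lin e.hom (lin e.inv y) = y := lin_inv_lin_hom e.symm y

theorem map_piece_eq {X Y : Obj R G} (e : X.carrier ≃ₗ[R] Y.carrier)
    (he : ∀ a, ∀ x ∈ X.piece a, e x ∈ Y.piece a) :
    (fun a => (X.piece a).map (e : X.carrier →ₗ[R] Y.carrier)) = Y.piece := by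
  refine eq_of_le_of_iSupIndep (fun a => Submodule.map_le_iff_le_comap.2 (he a)) Y.indep ?_
  rw [← Submodule.map_iSup, X.span, Submodule.map_top, LinearEquiv.range]

/-- The isomorphism given by a linear equivalence that preserves the grading. Its inverse
preserves the grading as well, by `map_piece_eq`. -/
def isoOfLinearEquiv {X Y : Obj R G} (e : X.carrier ≃ₗ[R] Y.carrier)
    (he : ∀ a, ∀ x ∈ X.piece a, e x ∈ Y.piece a) : X ≅ Y where
  hom := Hom.mk e.toLinearMap he
  inv := Hom.mk e.symm.toLinearMap fun a y hy => by
    rw [← congrFun (map_piece_eq e he) a] at hy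
    obtain ⟨x, hx, rfl⟩ := hy
    simpa using hx
  hom_inv_id := hom_ext (LinearMap.ext e.symm_apply_apply)
  inv_hom_id := hom_ext (LinearMap.ext e.apply_symm_apply)

@[simp] theorem lin_isoOfLinearEquiv_hom {X Y : Obj R G} (e : X.carrier ≃ₗ[R] Y.carrier)
    (he : ∀ a, ∀ x ∈ X.piece a, e x ∈ Y.piece a) (x : X.carrier) :
    lin (isoOfLinearEquiv e he).hom x = e x := rfl

/-- Multiplication by the unit `c a` in degree `a`. -/
def Obj.scale (X : Obj R G) (c : G → Rˣ) : X.carrier ≃ₗ[R] X.carrier :=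
  LinearEquiv.ofLinearMap (X.glue fun a => (c a : R) • LinearMap.id)
    (X.glue fun a => ((c a)⁻¹ : Rˣ) • LinearMap.id)
    (LinearMap.ext_on X.span_homogeneous (by
      rintro x ⟨a, hx⟩
      simp [X.glue_apply _ hx, Units.smul_def, smul_smul]))
    (LinearMap.ext_on X.span_homogeneous (by
      rintro x ⟨a, hx⟩
      simp [X.glue_apply _ hx, Units.smul_def, smul_smul]))

theorem Obj.scale_apply (X : Obj R G) (c : G → Rˣ) {a : G} {x : X.carrier} (hx : x ∈ X.piece a) :
    X.scale c x = (c a : R) • x := by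
  simp [scale, X.glue_apply _ hx]

theorem Obj.scale_mem (X : Obj R G) (c : G → Rˣ) {a : G} {x : X.carrier} (hx : x ∈ X.piece a) :
    X.scale c x ∈ X.piece a := by
  rw [X.scale_apply c hx]
  exact Submodule.smul_mem _ _ hx

theorem scale_lin {X Y : Obj R G} (f : X ⟶ Y) (c : G → Rˣ) (x : X.carrier) :
    Y.scale c (lin f x) = lin f (X.scale c x) := by
  refine LinearMap.congr_fun (f := (Y.scale c).toLinearMap ∘ₗ lin f)
    (g := lin f ∘ₗ (X.scale c).toLinearMap) (LinearMap.ext_on X.span_homogeneous ?_) x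
  rintro x ⟨a, hx⟩
  simp [X.scale_apply c hx, Y.scale_apply c (lin_mem f hx)]

theorem mem_simple_piece_iff {g a : G} {r : (simple R g).carrier} :
    r ∈ (simple R g).piece a ↔ a = g ∨ r = 0 := by
  have h (s : R) : s ∈ (⨆ (_ : a = g), ⊤ : Submodule R R) ↔ a = g ∨ s = 0 := by
    by_cases hag : a = g <;> simp [hag]
  exact h r

/-- The coordinate with respect to the generator of a simple object. -/
def simpleEquiv (R : Type u) [CommRing R] (g : G) : (simple R g).carrier ≃ₗ[R] R :=
  LinearEquiv.refl R R

/-- The generator of a simple object. -/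
def gen (R : Type u) [CommRing R] (g : G) : (simple R g).carrier := (1 : R)

theorem gen_mem (g : G) : gen R g ∈ (simple R g).piece g := mem_simple_piece_iff.2 (Or.inl rfl)

/-- The morphism from the simple object at `a` that sends the generator to `x`. -/
def ofElement {X : Obj R G} {a : G} (x : X.carrier) (hx : x ∈ X.piece a) : simple R a ⟶ X :=
  Hom.mk (X := simple R a) (LinearMap.toSpanSingleton R X.carrier x) fun g r hr => by
    obtain rfl | rfl := mem_simple_piece_iff.1 hr
    · exact (X.piece g).smul_mem _ hx
    · change (0 : R) • x ∈ X.piece g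
      simp

@[simp] theorem lin_ofElement_gen {X : Obj R G} {a : G} (x : X.carrier) (hx : x ∈ X.piece a) :
    lin (ofElement x hx) (gen R a) = x := one_smul R x

end GradedModules

section Products

variable {R : Type u} [CommRing R] {G : Type v} [Group G]

@[simp] theorem lin_tHom {X X' Y Y' : Obj R G} (f : X ⟶ X') (g : Y ⟶ Y') (x : X.carrier)
    (y : Y.carrier) : lin (tHom f g) (tmk x y) = tmk (lin f x) (lin g y) := rfl

@[simp] theorem smul_tmk {X Y : Obj R G} (r : R) (x : X.carrier) (y : Y.carrier) :
    (tmk (r • x) y : (tObj X Y).carrier) = r • tmk x y := (TensorProduct.smul_tmul' r x y).symm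

@[simp] theorem tmk_smul {X Y : Obj R G} (r : R) (x : X.carrier) (y : Y.carrier) :
    (tmk x (r • y) : (tObj X Y).carrier) = r • tmk x y := TensorProduct.tmul_smul r x y

@[simp] theorem zero_tmk {X Y : Obj R G} (y : Y.carrier) :
    (tmk (0 : X.carrier) y : (tObj X Y).carrier) = 0 := TensorProduct.zero_tmul _ y

@[simp] theorem tmk_zero {X Y : Obj R G} (x : X.carrier) :
    (tmk x (0 : Y.carrier) : (tObj X Y).carrier) = 0 := TensorProduct.tmul_zero _ x

theorem tmk_mem {X Y : Obj R G} {g h : G} {x : X.carrier} {y : Y.carrier}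
    (hx : x ∈ X.piece g) (hy : y ∈ Y.piece h) : tmk x y ∈ (tObj X Y).piece (g * h) :=
  tmul_mem_tensorPiece hx hy

section Extensionality

variable {M : Type*} [AddCommGroup M] [Module R M] {W X Y Z : Obj R G}

theorem span_tmk {S : Set X.carrier} {T : Set Y.carrier} (hS : Submodule.span R S = ⊤)
    (hT : Submodule.span R T = ⊤) :
    Submodule.span R {t : (tObj X Y).carrier | ∃ x ∈ S, ∃ y ∈ T, tmk x y = t} = ⊤ := by
  have h := Submodule.map₂_span_span R (TensorProduct.mk R X.carrier Y.carrier) S T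
  rw [hS, hT, TensorProduct.map₂_mk_top_top_eq_top] at h
  exact h.symm

theorem ext_tmk₂ {f g : (tObj X Y).carrier →ₗ[R] M}
    (h : ∀ a b, ∀ x ∈ X.piece a, ∀ y ∈ Y.piece b, f (tmk x y) = g (tmk x y)) : f = g := by
  refine LinearMap.ext_on (span_tmk X.span_homogeneous Y.span_homogeneous) ?_
  rintro _ ⟨x, ⟨a, hx⟩, y, ⟨b, hy⟩, rfl⟩
  exact h a b x hx y hy

theorem ext_tmk₃ {f g : (tObj (tObj X Y) Z).carrier →ₗ[R] M}
    (h : ∀ a b c, ∀ x ∈ X.piece a, ∀ y ∈ Y.piece b, ∀ z ∈ Z.piece c,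
      f (tmk (tmk x y) z) = g (tmk (tmk x y) z)) : f = g := by
  refine LinearMap.ext_on (span_tmk (span_tmk X.span_homogeneous Y.span_homogeneous)
    Z.span_homogeneous) ?_
  rintro _ ⟨_, ⟨x, ⟨a, hx⟩, y, ⟨b, hy⟩, rfl⟩, z, ⟨c, hz⟩, rfl⟩
  exact h a b c x hx y hy z hz

theorem ext_tmk₄ {f g : (tObj (tObj (tObj W X) Y) Z).carrier →ₗ[R] M}
    (h : ∀ a b c d, ∀ w ∈ W.piece a, ∀ x ∈ X.piece b, ∀ y ∈ Y.piece c, ∀ z ∈ Z.piece d,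
      f (tmk (tmk (tmk w x) y) z) = g (tmk (tmk (tmk w x) y) z)) : f = g := by
  refine LinearMap.ext_on (span_tmk (span_tmk (span_tmk W.span_homogeneous X.span_homogeneous)
    Y.span_homogeneous) Z.span_homogeneous) ?_
  rintro _ ⟨_, ⟨_, ⟨w, ⟨a, hw⟩, x, ⟨b, hx⟩, rfl⟩, y, ⟨c, hy⟩, rfl⟩, z, ⟨d, hz⟩, rfl⟩
  exact h a b c d w hw x hx y hy z hz

theorem map_mem_of_tmk {N : Submodule R M} (f : (tObj X Y).carrier →ₗ[R] M) {g : G}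
    (h : ∀ a b, a * b = g → ∀ x ∈ X.piece a, ∀ y ∈ Y.piece b, f (tmk x y) ∈ N) :
    ∀ t ∈ (tObj X Y).piece g, f t ∈ N := by
  change tensorPiece X Y g ≤ N.comap f
  refine Submodule.span_le.2 ?_
  rintro _ ⟨a, b, hab, x, hx, y, hy, rfl⟩
  exact h a b hab x hx y hy

theorem map_mem_of_tmk₃ {N : Submodule R M} (f : (tObj (tObj X Y) Z).carrier →ₗ[R] M) {g : G}
    (h : ∀ a b c, a * b * c = g → ∀ x ∈ X.piece a, ∀ y ∈ Y.piece b, ∀ z ∈ Z.piece c,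
      f (tmk (tmk x y) z) ∈ N) :
    ∀ t ∈ (tObj (tObj X Y) Z).piece g, f t ∈ N := by
  refine map_mem_of_tmk f ?_
  rintro d c rfl t ht z hz
  refine map_mem_of_tmk (f ∘ₗ (TensorProduct.mk R (tObj X Y).carrier Z.carrier).flip z) ?_ t ht
  rintro a b rfl x hx y hy
  exact h a b c rfl x hx y hy z hz

end Extensionality

section Scaling

variable (X Y Z : Obj R G)

theorem exists_linearMap_tmk_right (e : G → X.carrier →ₗ[R] X.carrier) :
    ∃ E : (tObj X Y).carrier →ₗ[R] (tObj X Y).carrier,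
      ∀ x b, ∀ y ∈ Y.piece b, E (tmk x y) = tmk (e b x) y := by
  let m : X.carrier →ₗ[R] Y.carrier →ₗ[R] (tObj X Y).carrier :=
    TensorProduct.mk R X.carrier Y.carrier
  refine ⟨TensorProduct.lift (Y.glue fun b => (m ∘ₗ e b).flip).flip, fun x b y hy => ?_⟩
  calc _ = (Y.glue fun b => (m ∘ₗ e b).flip) y x := TensorProduct.lift.tmul x y
    _ = _ := by rw [Y.glue_apply _ hy]; rfl

theorem exists_linearEquiv_tmk_right (e : G → X.carrier ≃ₗ[R] X.carrier) :
    ∃ E : (tObj X Y).carrier ≃ₗ[R] (tObj X Y).carrier,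
      ∀ x b, ∀ y ∈ Y.piece b, E (tmk x y) = tmk (e b x) y := by
  obtain ⟨E, hE⟩ := exists_linearMap_tmk_right X Y fun b => (e b).toLinearMap
  obtain ⟨F, hF⟩ := exists_linearMap_tmk_right X Y fun b => (e b).symm.toLinearMap
  refine ⟨LinearEquiv.ofLinearMap E F (ext_tmk₂ fun a b x _ y hy => ?_)
    (ext_tmk₂ fun a b x _ y hy => ?_), hE⟩ <;>
  simp [hE _ b y hy, hF _ b y hy]

/-- The automorphism of `X ⊗ Y` that applies `e b` to the left factor where the right factor has
degree `b`. -/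
def scaleLeft (e : G → X.carrier ≃ₗ[R] X.carrier) :
    (tObj X Y).carrier ≃ₗ[R] (tObj X Y).carrier :=
  (exists_linearEquiv_tmk_right X Y e).choose

variable {X Y Z}

theorem scaleLeft_tmk (e : G → X.carrier ≃ₗ[R] X.carrier) (x : X.carrier) {b : G}
    {y : Y.carrier} (hy : y ∈ Y.piece b) : scaleLeft X Y e (tmk x y) = tmk (e b x) y :=
  (exists_linearEquiv_tmk_right X Y e).choose_spec x b y hy

variable (X Y Z)

/-- Multiplication by `μ a b` in degrees `a`, `b`. -/
def scale₂ (μ : G → G → Rˣ) : (tObj X Y).carrier ≃ₗ[R] (tObj X Y).carrier :=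
  scaleLeft X Y fun b => X.scale fun a => μ a b

/-- Multiplication by `α a b c` in degrees `a`, `b`, `c`. -/
def scale₃ (α : G → G → G → Rˣ) :
    (tObj (tObj X Y) Z).carrier ≃ₗ[R] (tObj (tObj X Y) Z).carrier :=
  scaleLeft (tObj X Y) Z fun c => scale₂ X Y fun a b => α a b c

variable {X Y Z} {a b c : G} {x : X.carrier} {y : Y.carrier} {z : Z.carrier}

theorem scale₂_tmk (μ : G → G → Rˣ) (hx : x ∈ X.piece a) (hy : y ∈ Y.piece b) :
    scale₂ X Y μ (tmk x y) = (μ a b : R) • tmk x y := by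
  rw [scale₂, scaleLeft_tmk _ _ hy, X.scale_apply _ hx, smul_tmk]

theorem scale₃_tmk (α : G → G → G → Rˣ) (hx : x ∈ X.piece a) (hy : y ∈ Y.piece b)
    (hz : z ∈ Z.piece c) :
    scale₃ X Y Z α (tmk (tmk x y) z) = (α a b c : R) • tmk (tmk x y) z := by
  rw [scale₃, scaleLeft_tmk _ _ hz, scale₂_tmk _ hx hy, smul_tmk]

end Scaling

section StandardIsomorphisms

variable (X Y Z : Obj R G)

theorem scale₂_mem (μ : G → G → Rˣ) :
    ∀ g, ∀ t ∈ (tObj X Y).piece g, scale₂ X Y μ t ∈ (tObj X Y).piece g := by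
  refine fun g => map_mem_of_tmk (scale₂ X Y μ).toLinearMap ?_
  rintro a b rfl x hx y hy
  rw [LinearEquiv.coe_coe, scale₂_tmk μ hx hy]
  exact Submodule.smul_mem _ _ (tmk_mem hx hy)

/-- The automorphism of `X ⊗ Y` that multiplies by `μ a b` in degrees `a`, `b`. -/
def scaleIso (μ : G → G → Rˣ) : tObj X Y ≅ tObj X Y :=
  isoOfLinearEquiv (scale₂ X Y μ) (scale₂_mem X Y μ)

/-- The standard associativity isomorphism of the underlying modules. -/
def stdAssoc : (tObj (tObj X Y) Z).carrier ≃ₗ[R] (tObj X (tObj Y Z)).carrier :=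
  TensorProduct.assoc R X.carrier Y.carrier Z.carrier

/-- The standard commutativity isomorphism of the underlying modules. -/
def stdComm : (tObj X Y).carrier ≃ₗ[R] (tObj Y X).carrier :=
  TensorProduct.comm R X.carrier Y.carrier

/-- The standard left unit isomorphism of the underlying modules. -/
def stdLeftUnit : (tObj (simple R (1 : G)) X).carrier ≃ₗ[R] X.carrier :=
  TensorProduct.lid R X.carrier

/-- The standard right unit isomorphism of the underlying modules. -/
def stdRightUnit : (tObj X (simple R (1 : G))).carrier ≃ₗ[R] X.carrier :=
  TensorProduct.rid R X.carrier

variable {X Y Z}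

@[simp] theorem stdAssoc_tmk (x : X.carrier) (y : Y.carrier) (z : Z.carrier) :
    stdAssoc X Y Z (tmk (tmk x y) z) = tmk x (tmk y z) := rfl

@[simp] theorem stdComm_tmk (x : X.carrier) (y : Y.carrier) :
    stdComm X Y (tmk x y) = tmk y x := rfl

variable (X Y Z)

/-- The standard associativity isomorphism multiplied by `α a b c` in degrees `a`, `b`, `c`. -/
def assocIso (α : G → G → G → Rˣ) : tObj (tObj X Y) Z ≅ tObj X (tObj Y Z) :=
  isoOfLinearEquiv (scale₃ X Y Z α ≪≫ₗ stdAssoc X Y Z) fun _ =>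
    map_mem_of_tmk₃ (scale₃ X Y Z α ≪≫ₗ stdAssoc X Y Z).toLinearMap (by
      rintro a b c rfl x hx y hy z hz
      rw [LinearEquiv.coe_coe, LinearEquiv.trans_apply, scale₃_tmk α hx hy hz, map_smul, mul_assoc]
      exact Submodule.smul_mem _ _ (tmk_mem hx (tmk_mem hy hz)))

/-- The standard commutativity isomorphism multiplied by `τ a b` in degrees `a`, `b`. -/
def commIso (hG : ∀ a b : G, a * b = b * a) (τ : G → G → Rˣ) : tObj X Y ≅ tObj Y X :=
  isoOfLinearEquiv (scale₂ X Y τ ≪≫ₗ stdComm X Y) fun _ =>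
    map_mem_of_tmk (scale₂ X Y τ ≪≫ₗ stdComm X Y).toLinearMap (by
      rintro a b rfl x hx y hy
      rw [LinearEquiv.coe_coe, LinearEquiv.trans_apply, scale₂_tmk τ hx hy, map_smul, hG]
      exact Submodule.smul_mem _ _ (tmk_mem hy hx))

/-- The standard left unit isomorphism multiplied by `c a` in degree `a`. -/
def leftUnitIso (c : G → Rˣ) : tObj (simple R 1) X ≅ X :=
  isoOfLinearEquiv (stdLeftUnit X ≪≫ₗ X.scale c) fun _ =>
    map_mem_of_tmk (stdLeftUnit X ≪≫ₗ X.scale c).toLinearMap (by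
      rintro a b rfl r hr x hx
      refine X.scale_mem c ?_
      obtain rfl | rfl := mem_simple_piece_iff.1 hr
      · rw [one_mul]
        exact (X.piece b).smul_mem _ hx
      · change (0 : R) • x ∈ X.piece _
        simp)

/-- The standard right unit isomorphism multiplied by `c a` in degree `a`. -/
def rightUnitIso (c : G → Rˣ) : tObj X (simple R 1) ≅ X :=
  isoOfLinearEquiv (stdRightUnit X ≪≫ₗ X.scale c) fun _ =>
    map_mem_of_tmk (stdRightUnit X ≪≫ₗ X.scale c).toLinearMap (by
      rintro a b rfl x hx r hr
      refine X.scale_mem c ?_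
      obtain rfl | rfl := mem_simple_piece_iff.1 hr
      · rw [mul_one]
        exact (X.piece a).smul_mem _ hx
      · change (0 : R) • x ∈ X.piece _
        simp)

variable {X Y Z}

theorem lin_leftUnitIso_tmk (c : G → Rˣ) (r : (simple R (1 : G)).carrier) (x : X.carrier) :
    lin (leftUnitIso X c).hom (tmk r x) = simpleEquiv R 1 r • X.scale c x :=
  map_smul (X.scale c) (simpleEquiv R 1 r) x

theorem lin_rightUnitIso_tmk (c : G → Rˣ) (x : X.carrier) (r : (simple R (1 : G)).carrier) :
    lin (rightUnitIso X c).hom (tmk x r) = simpleEquiv R 1 r • X.scale c x :=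
  map_smul (X.scale c) (simpleEquiv R 1 r) x

end StandardIsomorphisms

end Products

section Generators

variable {R : Type u} [CommRing R]

/-- `x` is a basis of a free module of rank one. -/
def IsGenerator (R : Type*) [CommRing R] {M : Type*} [AddCommGroup M] [Module R M] (x : M) :
    Prop := ∃ φ : M ≃ₗ[R] R, φ x = 1

namespace IsGenerator

variable {M N : Type*} [AddCommGroup M] [Module R M] [AddCommGroup N] [Module R N] {x : M} {y : N}

theorem eq_of_smul_eq_smul (hx : IsGenerator R x) {r s : R} (h : r • x = s • x) : r = s := by
  obtain ⟨φ, hφ⟩ := hx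
  simpa [hφ] using congrArg φ h

theorem exists_eq_smul (hx : IsGenerator R x) (m : M) : ∃ r : R, m = r • x := by
  obtain ⟨φ, hφ⟩ := hx
  exact ⟨φ m, φ.injective (by simp [hφ])⟩

theorem exists_map_eq_units_smul (hx : IsGenerator R x) (hy : IsGenerator R y) (e : M ≃ₗ[R] N) :
    ∃ u : Rˣ, e x = (u : R) • y := by
  obtain ⟨r, hr⟩ := hy.exists_eq_smul (e x)
  obtain ⟨s, hs⟩ := hx.exists_eq_smul (e.symm y)
  have hrs : r * s = 1 := hx.eq_of_smul_eq_smul <| by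
    calc (r * s) • x = e.symm (r • y) := by rw [map_smul, hs, smul_smul]
      _ = (1 : R) • x := by rw [← hr, e.symm_apply_apply, one_smul]
  exact ⟨Units.mkOfMulEqOne r s hrs, hr⟩

theorem exists_lin_hom_eq_units_smul {G : Type v} {X Y : Obj R G} {x : X.carrier}
    {y : Y.carrier} (hx : IsGenerator R x) (hy : IsGenerator R y) (e : X ≅ Y) :
    ∃ u : Rˣ, lin e.hom x = (u : R) • y :=
  hx.exists_map_eq_units_smul hy (LinearEquiv.ofLinearMap (lin e.hom) (lin e.inv)
    (LinearMap.ext (lin_hom_lin_inv e)) (LinearMap.ext (lin_inv_lin_hom e)))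

theorem tmk {G : Type v} [Group G] {X Y : Obj R G} {x : X.carrier} {y : Y.carrier}
    (hx : IsGenerator R x) (hy : IsGenerator R y) : IsGenerator R (tmk x y) := by
  obtain ⟨φ, hφ⟩ := hx
  obtain ⟨ψ, hψ⟩ := hy
  refine ⟨TensorProduct.congr φ ψ ≪≫ₗ TensorProduct.lid R R, ?_⟩
  change φ x • ψ y = 1
  rw [hφ, hψ, smul_eq_mul, one_mul]

end IsGenerator

theorem isGenerator_gen {G : Type v} (g : G) : IsGenerator R (gen R g) :=
  ⟨simpleEquiv R g, rfl⟩

theorem isGenerator_tmk_gen {G : Type v} [Group G] (a b : G) :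
    IsGenerator R (tmk (gen R a) (gen R b)) :=
  (isGenerator_gen a).tmk (isGenerator_gen b)

end Generators

section Multiples

variable {R : Type u} [CommRing R] {G : Type v} [Group G]

/-- The maps `f X Y` are the standard maps `x ⊗ y ↦ t X Y x y` multiplied by `μ a b` in degrees
`a`, `b`. -/
def IsMultiple₂ {F : Obj R G → Obj R G → Obj R G} (f : ∀ X Y, tObj X Y ⟶ F X Y)
    (t : ∀ X Y : Obj R G, X.carrier → Y.carrier → (F X Y).carrier) (μ : G → G → Rˣ) : Prop :=
  ∀ (X Y : Obj R G) (a b : G), ∀ x ∈ X.piece a, ∀ y ∈ Y.piece b,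
    lin (f X Y) (tmk x y) = (μ a b : R) • t X Y x y

/-- The threefold analogue of `IsMultiple₂`. -/
def IsMultiple₃ {F : Obj R G → Obj R G → Obj R G → Obj R G}
    (f : ∀ X Y Z, tObj (tObj X Y) Z ⟶ F X Y Z)
    (t : ∀ X Y Z : Obj R G, X.carrier → Y.carrier → Z.carrier → (F X Y Z).carrier)
    (α : G → G → G → Rˣ) : Prop :=
  ∀ (X Y Z : Obj R G) (a b c : G), ∀ x ∈ X.piece a, ∀ y ∈ Y.piece b, ∀ z ∈ Z.piece c,
    lin (f X Y Z) (tmk (tmk x y) z) = (α a b c : R) • t X Y Z x y z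

/-- The fourfold analogue of `IsMultiple₂`. -/
def IsMultiple₄ {F : Obj R G → Obj R G → Obj R G → Obj R G → Obj R G}
    (f : ∀ W X Y Z, tObj (tObj (tObj W X) Y) Z ⟶ F W X Y Z)
    (t : ∀ W X Y Z : Obj R G, W.carrier → X.carrier → Y.carrier → Z.carrier →
      (F W X Y Z).carrier) (π : G → G → G → G → Rˣ) : Prop :=
  ∀ (W X Y Z : Obj R G) (a b c d : G), ∀ w ∈ W.piece a, ∀ x ∈ X.piece b, ∀ y ∈ Y.piece c,
    ∀ z ∈ Z.piece d,
      lin (f W X Y Z) (tmk (tmk (tmk w x) y) z) = (π a b c d : R) • t W X Y Z w x y z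

theorem IsMultiple₂.forall_eq_iff {F : Obj R G → Obj R G → Obj R G}
    {f g : ∀ X Y, tObj X Y ⟶ F X Y}
    {t : ∀ X Y : Obj R G, X.carrier → Y.carrier → (F X Y).carrier} {μ ν : G → G → Rˣ}
    (hf : IsMultiple₂ f t μ) (hg : IsMultiple₂ g t ν)
    (ht : ∀ a b, IsGenerator R (t _ _ (gen R a) (gen R b))) :
    (∀ X Y, f X Y = g X Y) ↔ ∀ a b, μ a b = ν a b := by
  refine ⟨fun h a b => Units.ext ((ht a b).eq_of_smul_eq_smul ?_), fun h X Y =>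
    hom_ext (ext_tmk₂ fun a b x hx y hy => ?_)⟩
  · rw [← hf _ _ a b _ (gen_mem a) _ (gen_mem b), ← hg _ _ a b _ (gen_mem a) _ (gen_mem b), h]
  · rw [hf X Y a b x hx y hy, hg X Y a b x hx y hy, h]

theorem IsMultiple₃.forall_eq_iff {F : Obj R G → Obj R G → Obj R G → Obj R G}
    {f g : ∀ X Y Z, tObj (tObj X Y) Z ⟶ F X Y Z}
    {t : ∀ X Y Z : Obj R G, X.carrier → Y.carrier → Z.carrier → (F X Y Z).carrier}
    {α β : G → G → G → Rˣ} (hf : IsMultiple₃ f t α) (hg : IsMultiple₃ g t β)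
    (ht : ∀ a b c, IsGenerator R (t _ _ _ (gen R a) (gen R b) (gen R c))) :
    (∀ X Y Z, f X Y Z = g X Y Z) ↔ ∀ a b c, α a b c = β a b c := by
  refine ⟨fun h a b c => Units.ext ((ht a b c).eq_of_smul_eq_smul ?_), fun h X Y Z =>
    hom_ext (ext_tmk₃ fun a b c x hx y hy z hz => ?_)⟩
  · rw [← hf _ _ _ a b c _ (gen_mem a) _ (gen_mem b) _ (gen_mem c),
      ← hg _ _ _ a b c _ (gen_mem a) _ (gen_mem b) _ (gen_mem c), h]
  · rw [hf X Y Z a b c x hx y hy z hz, hg X Y Z a b c x hx y hy z hz, h]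

theorem IsMultiple₄.forall_eq_iff {F : Obj R G → Obj R G → Obj R G → Obj R G → Obj R G}
    {f g : ∀ W X Y Z, tObj (tObj (tObj W X) Y) Z ⟶ F W X Y Z}
    {t : ∀ W X Y Z : Obj R G, W.carrier → X.carrier → Y.carrier → Z.carrier →
      (F W X Y Z).carrier} {π ρ : G → G → G → G → Rˣ}
    (hf : IsMultiple₄ f t π) (hg : IsMultiple₄ g t ρ)
    (ht : ∀ a b c d, IsGenerator R (t _ _ _ _ (gen R a) (gen R b) (gen R c) (gen R d))) :
    (∀ W X Y Z, f W X Y Z = g W X Y Z) ↔ ∀ a b c d, π a b c d = ρ a b c d := by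
  refine ⟨fun h a b c d => Units.ext ((ht a b c d).eq_of_smul_eq_smul ?_), fun h W X Y Z =>
    hom_ext (ext_tmk₄ fun a b c d w hw x hx y hy z hz => ?_)⟩
  · rw [← hf _ _ _ _ a b c d _ (gen_mem a) _ (gen_mem b) _ (gen_mem c) _ (gen_mem d),
      ← hg _ _ _ _ a b c d _ (gen_mem a) _ (gen_mem b) _ (gen_mem c) _ (gen_mem d), h]
  · rw [hf W X Y Z a b c d w hw x hx y hy z hz, hg W X Y Z a b c d w hw x hx y hy z hz, h]

end Multiples

section ScalarIdentities

variable {G : Type*} {H : Type*} [CommGroup H]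

/-- The identity between scalars that expresses the pentagon axiom. -/
def PentagonScalars [Mul G] (α : G → G → G → H) : Prop :=
  ∀ a b c d, α a b c * α a (b * c) d * α b c d = α (a * b) c d * α a b (c * d)

/-- The identity between scalars that expresses the hexagon axiom. -/
def HexagonScalars [Mul G] (α : G → G → G → H) (τ : G → G → H) : Prop :=
  ∀ a b c, α a b c * τ a (b * c) * α b c a = τ a b * α b a c * τ a c

/-- The identities between scalars that express the axioms of a braided structure. The second
hexagon axiom is the first one for the inverse braiding. -/
structure BraidedScalars [Mul G] (α : G → G → G → H) (τ : G → G → H) : Prop where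
  pentagon : PentagonScalars α
  hexagon : HexagonScalars α τ
  hexagon_inv : HexagonScalars α fun a b => (τ b a)⁻¹

/-- The factor by which the scalars of an associativity isomorphism change when it is carried along
multiplication of the product by `μ`. -/
def assocChange [Mul G] (μ : G → G → H) (a b c : G) : H :=
  μ b c * μ a (b * c) / (μ a b * μ (a * b) c)

/-- The factor by which the scalars of a commutativity isomorphism change when it is carried along
multiplication of the product by `μ`. -/
def commChange (μ : G → G → H) (a b : G) : H := μ b a / μ a b

theorem eq_mul_assocChange_iff [Mul G] {α α' : G → G → G → H} {μ : G → G → H} :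
    α' = α * assocChange μ ↔
      ∀ a b c, α a b c * (μ b c * μ a (b * c)) = μ a b * (μ (a * b) c * α' a b c) := by
  simp only [funext_iff, Pi.mul_apply, assocChange]
  refine forall₃_congr fun a b c => ?_
  rw [← mul_div_assoc, eq_div_iff_mul_eq', mul_comm, mul_assoc, eq_comm]

theorem eq_mul_commChange_iff {τ τ' μ : G → G → H} :
    τ' = τ * commChange μ ↔ ∀ a b, τ a b * μ b a = μ a b * τ' a b := by
  simp only [funext_iff, Pi.mul_apply, commChange]
  refine forall₂_congr fun a b => ?_
  rw [← mul_div_assoc, eq_div_iff_mul_eq', mul_comm, eq_comm]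

theorem pentagonScalars_assocChange [Semigroup G] (μ : G → G → H) :
    PentagonScalars (assocChange μ) := by
  intro a b c d
  apply Additive.ofMul.injective
  simp only [assocChange, mul_assoc, ofMul_mul, ofMul_div]
  abel

theorem hexagonScalars_change [Mul G] (hG : ∀ a b : G, a * b = b * a) (μ : G → G → H) :
    HexagonScalars (assocChange μ) (commChange μ) := by
  intro a b c
  apply Additive.ofMul.injective
  simp only [assocChange, commChange, hG b a, hG c a, ofMul_mul, ofMul_div]
  abel

theorem braidedScalars_change [Semigroup G] (hG : ∀ a b : G, a * b = b * a) (μ : G → G → H) :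
    BraidedScalars (assocChange μ) (commChange μ) where
  pentagon := pentagonScalars_assocChange μ
  hexagon := hexagonScalars_change hG μ
  hexagon_inv := by
    have hsymm : (fun a b => (commChange μ b a)⁻¹) = commChange μ :=
      funext₂ fun _ _ => inv_div _ _
    simpa only [hsymm] using hexagonScalars_change hG μ

theorem PentagonScalars.apply_one_middle [MulOneClass G] {α : G → G → G → H}
    (h : PentagonScalars α) (a b : G) : α a 1 b = α a 1 1 * α 1 1 b := by
  have e := h a 1 1 b
  simp only [mul_one, one_mul] at e
  rw [mul_right_comm] at e
  exact (mul_right_cancel e).symm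

end ScalarIdentities

section Associativity

variable {R : Type u} [CommRing R] {G : Type v} [Group G]

theorem isMultiple_assocIso (α : G → G → G → Rˣ) :
    IsMultiple₃ (fun X Y Z : Obj R G => (assocIso X Y Z α).hom) (fun _ _ _ x y z => tmk x (tmk y z))
      α := by
  intro X Y Z a b c x hx y hy z hz
  simp [assocIso, scale₃_tmk α hx hy hz]

theorem pentagon_iff {iso : ∀ X Y Z : Obj R G, tObj (tObj X Y) Z ≅ tObj X (tObj Y Z)}
    {α : G → G → G → Rˣ}
    (h : IsMultiple₃ (fun X Y Z => (iso X Y Z).hom) (fun _ _ _ x y z => tmk x (tmk y z)) α) :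
    (∀ W X Y Z : Obj R G,
      tHom (iso W X Y).hom (𝟙 Z) ≫ (iso W (tObj X Y) Z).hom ≫ tHom (𝟙 W) (iso X Y Z).hom
        = (iso (tObj W X) Y Z).hom ≫ (iso W X (tObj Y Z)).hom) ↔ PentagonScalars α := by
  refine IsMultiple₄.forall_eq_iff (t := fun _ _ _ _ w x y z => tmk w (tmk x (tmk y z)))
    (π := fun a b c d => α a b c * α a (b * c) d * α b c d)
    (ρ := fun a b c d => α (a * b) c d * α a b (c * d)) ?_ ?_ fun a b c d =>
      (isGenerator_gen a).tmk ((isGenerator_gen b).tmk (isGenerator_tmk_gen c d))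
  · intro W X Y Z a b c d w hw x hx y hy z hz
    simp [h _ _ _ _ _ _ _ hw _ hx _ hy, h _ _ _ _ _ _ _ hw _ (tmk_mem hx hy) _ hz,
      h _ _ _ _ _ _ _ hx _ hy _ hz, smul_smul, mul_assoc]
  · intro W X Y Z a b c d w hw x hx y hy z hz
    simp [h _ _ _ _ _ _ _ (tmk_mem hw hx) _ hy _ hz, h _ _ _ _ _ _ _ hw _ hx _ (tmk_mem hy hz),
      smul_smul]

namespace AssocStr

theorem exists_hasScalars (A : AssocStr R G) : ∃ α, A.HasScalars α := by
  choose α hα using fun a b c => ((isGenerator_tmk_gen a b).tmk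
    (isGenerator_gen c)).exists_lin_hom_eq_units_smul ((isGenerator_gen a).tmk
      (isGenerator_tmk_gen b c)) (A.iso (simple R a) (simple R b) (simple R c))
  refine ⟨α, fun X Y Z a b c x hx y hy z hz => ?_⟩
  have hnat := congrArg (fun f => lin f (tmk (tmk (gen R a) (gen R b)) (gen R c)))
    (A.natural (ofElement x hx) (ofElement y hy) (ofElement z hz))
  simpa [hα] using hnat

theorem HasScalars.eq_iff {A A' : AssocStr R G} {α α' : G → G → G → Rˣ}
    (h : A.HasScalars α) (h' : A'.HasScalars α') : A = A' ↔ α = α' := by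
  have hiso : (∀ X Y Z, (A.iso X Y Z).hom = (A'.iso X Y Z).hom) ↔ ∀ a b c, α a b c = α' a b c :=
    IsMultiple₃.forall_eq_iff h h' fun a b c => (isGenerator_gen a).tmk (isGenerator_tmk_gen b c)
  refine ⟨fun hA => ?_, fun hα => ?_⟩
  · funext a b c
    exact hiso.1 (fun _ _ _ => by rw [hA]) a b c
  · cases A
    cases A'
    congr
    funext X Y Z
    exact Iso.ext (hiso.2 (fun _ _ _ => by rw [hα]) X Y Z)

theorem HasScalars.pentagonScalars {A : AssocStr R G} {α : G → G → G → Rˣ}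
    (h : A.HasScalars α) : PentagonScalars α := (pentagon_iff h).1 A.pentagon

/-- The associativity structure whose isomorphism is the standard one multiplied by `α`. -/
def ofScalars (α : G → G → G → Rˣ) (hα : PentagonScalars α) : AssocStr R G where
  iso X Y Z := assocIso X Y Z α
  natural f g h := hom_ext (ext_tmk₃ fun a b c x hx y hy z hz => by
    simp [isMultiple_assocIso α _ _ _ _ _ _ _ hx _ hy _ hz,
      isMultiple_assocIso α _ _ _ _ _ _ _ (lin_mem f hx) _ (lin_mem g hy) _ (lin_mem h hz)])
  pentagon := (pentagon_iff (isMultiple_assocIso α)).2 hα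

theorem ofScalars_hasScalars (α : G → G → G → Rˣ) (hα : PentagonScalars α) :
    (ofScalars α hα).HasScalars α := isMultiple_assocIso α

variable (R G) in
/-- Associativity structures correspond to scalars that satisfy the pentagon identity. -/
def equivScalars : {α : G → G → G → Rˣ // PentagonScalars α} ≃ AssocStr R G :=
  Equiv.ofBijective (fun α => ofScalars α.1 α.2)
    ⟨fun α β h => Subtype.ext
        (((ofScalars_hasScalars α.1 α.2).eq_iff (ofScalars_hasScalars β.1 β.2)).1 h),
      fun A => by
        obtain ⟨α, hα⟩ := A.exists_hasScalars
        exact ⟨⟨α, hα.pentagonScalars⟩, ((ofScalars_hasScalars α _).eq_iff hα).2 rfl⟩⟩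

theorem equivScalars_hasScalars (α : {α : G → G → G → Rˣ // PentagonScalars α}) :
    (equivScalars R G α).HasScalars α.1 := ofScalars_hasScalars α.1 α.2

end AssocStr

end Associativity

section Units

variable {R : Type u} [CommRing R] {G : Type v} [Group G]

theorem nonempty_unitStr (A : AssocStr R G) : Nonempty (UnitStr A) := by
  obtain ⟨α, hα⟩ := A.exists_hasScalars
  refine ⟨{
    left := fun X => leftUnitIso X fun a => (α 1 1 a)⁻¹
    right := fun X => rightUnitIso X fun a => α a 1 1
    left_natural := fun f => hom_ext (ext_tmk₂ fun _ _ r _ x _ => ?_)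
    right_natural := fun f => hom_ext (ext_tmk₂ fun _ _ x _ r _ => ?_)
    triangle := fun X Y => hom_ext (ext_tmk₃ fun a b c x hx r hr y hy => ?_) }⟩
  · simp only [lin_comp, lin_tHom, lin_id, lin_leftUnitIso_tmk, scale_lin, map_smul]
  · simp only [lin_comp, lin_tHom, lin_id, lin_rightUnitIso_tmk, scale_lin, map_smul]
  · obtain rfl | rfl := mem_simple_piece_iff.1 hr
    · have hscalar : α a 1 c * (α 1 1 c)⁻¹ = α a 1 1 := by
        rw [hα.pentagonScalars.apply_one_middle, mul_inv_cancel_right]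
      simp only [lin_comp, lin_tHom, lin_id, hα _ _ _ _ _ _ _ hx _ hr _ hy, map_smul,
        lin_leftUnitIso_tmk, lin_rightUnitIso_tmk, X.scale_apply _ hx, Y.scale_apply _ hy,
        smul_tmk, tmk_smul, smul_smul]
      rw [← hscalar, Units.val_mul]
      congr 1
      ring
    · simp only [tmk_zero, zero_tmk, map_zero]

end Units

section ProductAutomorphisms

variable {R : Type u} [CommRing R] {G : Type v} [Group G]

theorem isMultiple_scaleIso (μ : G → G → Rˣ) :
    IsMultiple₂ (fun X Y : Obj R G => (scaleIso X Y μ).hom) (fun _ _ x y => tmk x y) μ := by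
  intro X Y a b x hx y hy
  simp only [scaleIso, lin_isoOfLinearEquiv_hom, scale₂_tmk μ hx hy]

namespace ProductAut

theorem exists_hasScalars (T : ProductAut R G) : ∃ μ, T.HasScalars μ := by
  choose μ hμ using fun a b => (isGenerator_tmk_gen a b).exists_lin_hom_eq_units_smul
    (isGenerator_tmk_gen a b) (T.iso (simple R a) (simple R b))
  refine ⟨μ, fun X Y a b x hx y hy => ?_⟩
  have hnat := congrArg (fun f => lin f (tmk (gen R a) (gen R b)))
    (T.natural (ofElement x hx) (ofElement y hy))
  simpa [hμ] using hnat

theorem HasScalars.eq_iff {T T' : ProductAut R G} {μ μ' : G → G → Rˣ}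
    (h : T.HasScalars μ) (h' : T'.HasScalars μ') : T = T' ↔ μ = μ' := by
  have hiso : (∀ X Y, (T.iso X Y).hom = (T'.iso X Y).hom) ↔ ∀ a b, μ a b = μ' a b :=
    IsMultiple₂.forall_eq_iff h h' isGenerator_tmk_gen
  refine ⟨fun hT => ?_, fun hμ => ?_⟩
  · funext a b
    exact hiso.1 (fun _ _ => by rw [hT]) a b
  · cases T
    cases T'
    congr
    funext X Y
    exact Iso.ext (hiso.2 (fun _ _ => by rw [hμ]) X Y)

/-- Multiplication by `μ`, as an automorphism of the product. -/
def ofScalars (μ : G → G → Rˣ) : ProductAut R G where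
  iso X Y := scaleIso X Y μ
  natural f g := hom_ext (ext_tmk₂ fun a b x hx y hy => by
    simp [isMultiple_scaleIso μ _ _ _ _ _ hx _ hy,
      isMultiple_scaleIso μ _ _ _ _ _ (lin_mem f hx) _ (lin_mem g hy)])

theorem ofScalars_hasScalars (μ : G → G → Rˣ) : (ofScalars μ : ProductAut R G).HasScalars μ :=
  isMultiple_scaleIso μ

variable (R G) in
/-- Automorphisms of the product correspond to arbitrary families of scalars. -/
def equivScalars : (G → G → Rˣ) ≃ ProductAut R G :=
  Equiv.ofBijective ofScalars
    ⟨fun μ ν h => ((ofScalars_hasScalars μ).eq_iff (ofScalars_hasScalars ν)).1 h,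
      fun T => T.exists_hasScalars.imp fun μ hμ => ((ofScalars_hasScalars μ).eq_iff hμ).2 rfl⟩

theorem equivScalars_hasScalars (μ : G → G → Rˣ) : (equivScalars R G μ).HasScalars μ :=
  ofScalars_hasScalars μ

theorem carriesAssoc_iff {T : ProductAut R G} {A A' : AssocStr R G} {μ : G → G → Rˣ}
    {α α' : G → G → G → Rˣ} (hT : T.HasScalars μ) (hA : A.HasScalars α) (hA' : A'.HasScalars α') :
    T.CarriesAssoc A A' ↔ α' = α * assocChange μ := by
  rw [eq_mul_assocChange_iff]
  refine IsMultiple₃.forall_eq_iff (t := fun _ _ _ x y z => tmk x (tmk y z))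
    (α := fun a b c => α a b c * (μ b c * μ a (b * c)))
    (β := fun a b c => μ a b * (μ (a * b) c * α' a b c)) ?_ ?_ fun a b c =>
      (isGenerator_gen a).tmk (isGenerator_tmk_gen b c)
  · intro X Y Z a b c x hx y hy z hz
    simp [hA _ _ _ _ _ _ _ hx _ hy _ hz, hT _ _ _ _ _ hy _ hz,
      hT _ _ _ _ _ hx _ (tmk_mem hy hz), smul_smul]
  · intro X Y Z a b c x hx y hy z hz
    simp [hT _ _ _ _ _ hx _ hy, hT _ _ _ _ _ (tmk_mem hx hy) _ hz,
      hA' _ _ _ _ _ _ _ hx _ hy _ hz, smul_smul]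

theorem carriesBraided_iff {T : ProductAut R G} {B B' : BraidedStr R G} {μ : G → G → Rˣ}
    {α α' : G → G → G → Rˣ} {τ τ' : G → G → Rˣ} (hT : T.HasScalars μ)
    (hα : B.toAssocStr.HasScalars α) (hτ : B.CommHasScalars τ)
    (hα' : B'.toAssocStr.HasScalars α') (hτ' : B'.CommHasScalars τ') :
    T.CarriesBraided B B' ↔ α' = α * assocChange μ ∧ τ' = τ * commChange μ := by
  rw [eq_mul_commChange_iff]
  refine and_congr (carriesAssoc_iff hT hα hα') (IsMultiple₂.forall_eq_iff
    (t := fun _ _ x y => tmk y x) (μ := fun a b => τ a b * μ b a)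
    (ν := fun a b => μ a b * τ' a b) ?_ ?_ fun a b => isGenerator_tmk_gen b a)
  · intro X Y a b x hx y hy
    simp [hτ _ _ _ _ _ hx _ hy, hT _ _ _ _ _ hy _ hx, smul_smul]
  · intro X Y a b x hx y hy
    simp [hT _ _ _ _ _ hx _ hy, hτ' _ _ _ _ _ hx _ hy, smul_smul]

end ProductAut

end ProductAutomorphisms

section Braidings

variable {R : Type u} [CommRing R] {G : Type v} [Group G]

theorem isMultiple_commIso (hG : ∀ a b : G, a * b = b * a) (τ : G → G → Rˣ) :
    IsMultiple₂ (fun X Y : Obj R G => (commIso X Y hG τ).hom) (fun _ _ x y => tmk y x) τ := by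
  intro X Y a b x hx y hy
  simp [commIso, scale₂_tmk τ hx hy]

section Hexagons

variable {iso : ∀ X Y Z : Obj R G, tObj (tObj X Y) Z ≅ tObj X (tObj Y Z)}
  {comm : ∀ X Y : Obj R G, tObj X Y ≅ tObj Y X} {α : G → G → G → Rˣ} {τ : G → G → Rˣ}

theorem hexagon_iff
    (hα : IsMultiple₃ (fun X Y Z => (iso X Y Z).hom) (fun _ _ _ x y z => tmk x (tmk y z)) α)
    (hτ : IsMultiple₂ (fun X Y => (comm X Y).hom) (fun _ _ x y => tmk y x) τ) :
    (∀ X Y Z : Obj R G,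
      (iso X Y Z).hom ≫ (comm X (tObj Y Z)).hom ≫ (iso Y Z X).hom
        = tHom (comm X Y).hom (𝟙 Z) ≫ (iso Y X Z).hom ≫ tHom (𝟙 Y) (comm X Z).hom) ↔
      HexagonScalars α τ := by
  refine IsMultiple₃.forall_eq_iff (t := fun _ _ _ x y z => tmk y (tmk z x))
    (α := fun a b c => α a b c * τ a (b * c) * α b c a)
    (β := fun a b c => τ a b * α b a c * τ a c) ?_ ?_ fun a b c =>
      (isGenerator_gen b).tmk (isGenerator_tmk_gen c a)
  · intro X Y Z a b c x hx y hy z hz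
    simp [hα _ _ _ _ _ _ _ hx _ hy _ hz, hα _ _ _ _ _ _ _ hy _ hz _ hx,
      hτ _ _ _ _ _ hx _ (tmk_mem hy hz), smul_smul, mul_assoc]
  · intro X Y Z a b c x hx y hy z hz
    simp [hα _ _ _ _ _ _ _ hy _ hx _ hz, hτ _ _ _ _ _ hx _ hy, hτ _ _ _ _ _ hx _ hz, smul_smul,
      mul_assoc]

theorem isMultiple_symm (hτ : IsMultiple₂ (fun X Y => (comm X Y).hom) (fun _ _ x y => tmk y x) τ) :
    IsMultiple₂ (fun X Y => (comm Y X).symm.hom) (fun _ _ x y => tmk y x)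
      fun a b => (τ b a)⁻¹ := by
  intro X Y a b x hx y hy
  have h := congrArg (fun t => ((τ b a)⁻¹ : Rˣ) • lin (comm Y X).inv t) (hτ Y X b a y hy x hx)
  simpa [lin_inv_lin_hom, Units.smul_def, smul_smul] using h.symm

/-- The tensor product of isomorphisms. -/
def tIso {X X' Y Y' : Obj R G} (e : X ≅ X') (e' : Y ≅ Y') : tObj X Y ≅ tObj X' Y' where
  hom := tHom e.hom e'.hom
  inv := tHom e.inv e'.inv
  hom_inv_id := by rw [← tHom_comp, e.hom_inv_id, e'.hom_inv_id, tHom_id]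
  inv_hom_id := by rw [← tHom_comp, e.inv_hom_id, e'.inv_hom_id, tHom_id]

theorem hexagon_reverse_iff_hexagon_symm (X Y Z : Obj R G) :
    (iso X Y Z).inv ≫ (comm (tObj X Y) Z).hom ≫ (iso Z X Y).inv
        = tHom (𝟙 X) (comm Y Z).hom ≫ (iso X Z Y).inv ≫ tHom (comm X Z).hom (𝟙 Y) ↔
      (iso Z X Y).hom ≫ (comm (tObj X Y) Z).symm.hom ≫ (iso X Y Z).hom
        = tHom (comm X Z).symm.hom (𝟙 Y) ≫ (iso X Z Y).hom ≫ tHom (𝟙 X) (comm Y Z).symm.hom := by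
  simpa [tIso] using Iso.inv_eq_inv
    ((iso Z X Y) ≪≫ (comm (tObj X Y) Z).symm ≪≫ (iso X Y Z))
    (tIso (comm X Z).symm (Iso.refl Y) ≪≫ (iso X Z Y) ≪≫ tIso (Iso.refl X) (comm Y Z).symm)

theorem hexagon_reverse_iff
    (hα : IsMultiple₃ (fun X Y Z => (iso X Y Z).hom) (fun _ _ _ x y z => tmk x (tmk y z)) α)
    (hτ : IsMultiple₂ (fun X Y => (comm X Y).hom) (fun _ _ x y => tmk y x) τ) :
    (∀ X Y Z : Obj R G,
      (iso X Y Z).inv ≫ (comm (tObj X Y) Z).hom ≫ (iso Z X Y).inv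
        = tHom (𝟙 X) (comm Y Z).hom ≫ (iso X Z Y).inv ≫ tHom (comm X Z).hom (𝟙 Y)) ↔
      HexagonScalars α fun a b => (τ b a)⁻¹ := by
  simp only [hexagon_reverse_iff_hexagon_symm, ← hexagon_iff hα (isMultiple_symm hτ)]
  exact ⟨fun h Z X Y => h X Y Z, fun h X Y Z => h Z X Y⟩

theorem symmetry_iff
    (hτ : IsMultiple₂ (fun X Y => (comm X Y).hom) (fun _ _ x y => tmk y x) τ) :
    (∀ X Y : Obj R G, (comm X Y).hom ≫ (comm Y X).hom = 𝟙 (tObj X Y)) ↔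
      ∀ a b, τ a b * τ b a = 1 := by
  refine IsMultiple₂.forall_eq_iff (t := fun _ _ x y => tmk x y) (μ := fun a b => τ a b * τ b a)
    (ν := fun _ _ => 1) ?_ ?_ isGenerator_tmk_gen
  · intro X Y a b x hx y hy
    simp [hτ _ _ _ _ _ hx _ hy, hτ _ _ _ _ _ hy _ hx, smul_smul]
  · intro X Y a b x _ y _
    simp

end Hexagons

namespace BraidedStr

theorem exists_commHasScalars (B : BraidedStr R G) : ∃ τ, B.CommHasScalars τ := by
  choose τ hτ using fun a b => (isGenerator_tmk_gen a b).exists_lin_hom_eq_units_smul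
    (isGenerator_tmk_gen b a) (B.comm (simple R a) (simple R b))
  refine ⟨τ, fun X Y a b x hx y hy => ?_⟩
  have hnat := congrArg (fun f => lin f (tmk (gen R a) (gen R b)))
    (B.comm_natural (ofElement x hx) (ofElement y hy))
  simpa only [lin_comp, lin_tHom, lin_ofElement_gen, hτ, map_smul] using hnat

theorem eq_iff {B B' : BraidedStr R G} {α α' : G → G → G → Rˣ} {τ τ' : G → G → Rˣ}
    (hα : B.toAssocStr.HasScalars α) (hτ : B.CommHasScalars τ) (hα' : B'.toAssocStr.HasScalars α')
    (hτ' : B'.CommHasScalars τ') : B = B' ↔ α = α' ∧ τ = τ' := by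
  have hcomm : (∀ X Y, (B.comm X Y).hom = (B'.comm X Y).hom) ↔ ∀ a b, τ a b = τ' a b :=
    IsMultiple₂.forall_eq_iff hτ hτ' fun a b => isGenerator_tmk_gen b a
  refine ⟨fun hB => ⟨(hα.eq_iff hα').1 (by rw [hB]), ?_⟩, fun h => ?_⟩
  · funext a b
    exact hcomm.1 (fun _ _ => by rw [hB]) a b
  · have hassoc := (hα.eq_iff hα').2 h.1
    cases B
    cases B'
    congr
    funext X Y
    exact Iso.ext (hcomm.2 (fun _ _ => by rw [h.2]) X Y)

theorem braidedScalars {B : BraidedStr R G} {α : G → G → G → Rˣ} {τ : G → G → Rˣ}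
    (hα : B.toAssocStr.HasScalars α) (hτ : B.CommHasScalars τ) : BraidedScalars α τ where
  pentagon := hα.pentagonScalars
  hexagon := (hexagon_iff hα hτ).1 B.hexagon_forward
  hexagon_inv := (hexagon_reverse_iff hα hτ).1 B.hexagon_reverse

variable (hG : ∀ a b : G, a * b = b * a)

/-- The braided structure whose isomorphisms are the standard ones multiplied by `α` and `τ`. -/
def ofScalars {α : G → G → G → Rˣ} {τ : G → G → Rˣ} (h : BraidedScalars α τ) :
    BraidedStr R G where
  toAssocStr := AssocStr.ofScalars α h.pentagon
  comm X Y := commIso X Y hG τ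
  comm_natural f g := hom_ext (ext_tmk₂ fun a b x hx y hy => by
    simp [isMultiple_commIso hG τ _ _ _ _ _ hx _ hy,
      isMultiple_commIso hG τ _ _ _ _ _ (lin_mem f hx) _ (lin_mem g hy)])
  hexagon_forward := (hexagon_iff (isMultiple_assocIso α) (isMultiple_commIso hG τ)).2 h.hexagon
  hexagon_reverse :=
    (hexagon_reverse_iff (isMultiple_assocIso α) (isMultiple_commIso hG τ)).2 h.hexagon_inv

theorem ofScalars_hasScalars {α : G → G → G → Rˣ} {τ : G → G → Rˣ} (h : BraidedScalars α τ) :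
    (ofScalars hG h : BraidedStr R G).toAssocStr.HasScalars α :=
  AssocStr.ofScalars_hasScalars α h.pentagon

theorem ofScalars_commHasScalars {α : G → G → G → Rˣ} {τ : G → G → Rˣ} (h : BraidedScalars α τ) :
    (ofScalars hG h : BraidedStr R G).CommHasScalars τ := isMultiple_commIso hG τ

variable (R) in
/-- Braided structures correspond to scalars that satisfy the pentagon and hexagon identities. -/
def equivScalars :
    {p : (G → G → G → Rˣ) × (G → G → Rˣ) // BraidedScalars p.1 p.2} ≃ BraidedStr R G :=
  Equiv.ofBijective (fun p => ofScalars hG p.2)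
    ⟨fun p q h => Subtype.ext (Prod.ext_iff.2
        ((eq_iff (ofScalars_hasScalars hG p.2) (ofScalars_commHasScalars hG p.2)
          (ofScalars_hasScalars hG q.2) (ofScalars_commHasScalars hG q.2)).1 h)),
      fun B => by
        obtain ⟨α, hα⟩ := B.toAssocStr.exists_hasScalars
        obtain ⟨τ, hτ⟩ := B.exists_commHasScalars
        have hp := braidedScalars hα hτ
        exact ⟨⟨(α, τ), hp⟩, (eq_iff (ofScalars_hasScalars hG hp) (ofScalars_commHasScalars hG hp)
          hα hτ).2 ⟨rfl, rfl⟩⟩⟩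

theorem equivScalars_hasScalars
    (p : {p : (G → G → G → Rˣ) × (G → G → Rˣ) // BraidedScalars p.1 p.2}) :
    (equivScalars R hG p).toAssocStr.HasScalars p.1.1 ∧
      (equivScalars R hG p).CommHasScalars p.1.2 :=
  ⟨ofScalars_hasScalars hG p.2, ofScalars_commHasScalars hG p.2⟩

end BraidedStr

namespace SymmetricStr

/-- A symmetric structure is a braided structure that satisfies the symmetry axiom. -/
def subtypeEquiv :
    {B : BraidedStr R G // ∀ X Y, (B.comm X Y).hom ≫ (B.comm Y X).hom = 𝟙 (tObj X Y)} ≃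
      SymmetricStr R G where
  toFun B := { B.1 with symmetry := B.2 }
  invFun S := ⟨S.toBraidedStr, S.symmetry⟩
  left_inv _ := rfl
  right_inv _ := rfl

variable (hG : ∀ a b : G, a * b = b * a)

variable (R) in
/-- Symmetric structures correspond to scalars that satisfy the pentagon, hexagon and symmetry
identities. -/
def equivScalars :
    {p : (G → G → G → Rˣ) × (G → G → Rˣ) //
      BraidedScalars p.1 p.2 ∧ ∀ a b, p.2 a b * p.2 b a = 1} ≃ SymmetricStr R G :=
  calc _ ≃ {q : {p : (G → G → G → Rˣ) × (G → G → Rˣ) // BraidedScalars p.1 p.2} //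
        ∀ a b, q.1.2 a b * q.1.2 b a = 1} :=
      (Equiv.subtypeSubtypeEquivSubtypeInter
        (fun p : (G → G → G → Rˣ) × (G → G → Rˣ) => BraidedScalars p.1 p.2)
        fun p => ∀ a b, p.2 a b * p.2 b a = 1).symm
    _ ≃ {B : BraidedStr R G // ∀ X Y, (B.comm X Y).hom ≫ (B.comm Y X).hom = 𝟙 (tObj X Y)} :=
      (BraidedStr.equivScalars R hG).subtypeEquiv fun q =>
        (symmetry_iff (BraidedStr.equivScalars_hasScalars hG q).2).symm
    _ ≃ SymmetricStr R G := subtypeEquiv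

theorem equivScalars_hasScalars
    (p : {p : (G → G → G → Rˣ) × (G → G → Rˣ) //
      BraidedScalars p.1 p.2 ∧ ∀ a b, p.2 a b * p.2 b a = 1}) :
    (equivScalars R hG p).toAssocStr.HasScalars p.1.1 ∧
      (equivScalars R hG p).toBraidedStr.CommHasScalars p.1.2 :=
  BraidedStr.equivScalars_hasScalars hG ⟨p.1, p.2.1⟩

end SymmetricStr

end Braidings

section Chains

namespace CellData

variable {S : Type*} {A : CellData S}

/-- The cell `x` as a chain of degree one higher, by passing from the cells `x` to the cells
`Δ¹ × x` of the bar construction. -/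
def suspend : (S →₀ ℤ) →+ (List S →₀ ℤ) := Finsupp.mapDomain.addMonoidHom fun x => [x]

@[simp]
theorem suspend_single (x : S) (k : ℤ) : suspend (.single x k) = .single [x] k :=
  Finsupp.mapDomain_single

theorem bar_dim_cons (x : S) (l : List S) : A.bar.dim (x :: l) = 1 + A.dim x + A.bar.dim l := by
  simp only [bar, tupleDim, List.length_cons, List.map_cons, List.sum_cons]
  ring

theorem bar_bd_singleton {x : S} (hx : A.dim x ≠ 0) : A.bar.bd [x] = -suspend (A.bd x) := by
  simp [bar, barBd, Finset.sum_range_succ, face, tupleBd, hx, suspend]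

theorem bar_bd_pair {x y : S} (hx : A.dim x ≠ 0) (hy : A.dim y ≠ 0) :
    A.bar.bd [x, y] = -suspend (A.mul x y) + ((A.bd x).mapDomain (fun z => [z, y])
      + (-1 : ℤ) ^ A.dim x • (A.bd y).mapDomain fun z => [x, z]) := by
  simp [bar, barBd, Finset.sum_range_succ, face, tupleBd, hx, hy, suspend, ← Finsupp.mapDomain_comp,
    Function.comp_def]

theorem bar_mul_singletons (x y : S) : A.bar.mul [x] [y] =
    (-1 : ℤ) ^ A.dim x • (.single [x, y] 1 + (-1 : ℤ) ^ (1 + A.dim y * A.dim x) • .single [y, x] 1)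
    := by
  simp [bar, barMul, shuffle, tupleDim]

theorem bar_cell_cases {k : ℕ} {l : List S} (hl : ∀ x ∈ l, k ≤ A.dim x)
    (hd : A.bar.dim l < 3 * (1 + k)) : l = [] ∨ (∃ x, l = [x]) ∨ ∃ x y, l = [x, y] := by
  match l with
  | [] => exact .inl rfl
  | [x] => exact .inr (.inl ⟨x, rfl⟩)
  | [x, y] => exact .inr (.inr ⟨x, y, rfl⟩)
  | x :: y :: z :: t =>
    simp only [List.forall_mem_cons] at hl
    simp only [bar_dim_cons] at hd
    omega

variable {P : S → Prop} {H : Type*} [CommGroup H] {n : ℕ}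

/-- The value of a cochain on chains, in additive notation. -/
def Cochain.eval (f : A.Cochain P H n) : (S →₀ ℤ) →+ Additive H :=
  Finsupp.liftAddHom fun x => zmultiplesHom (Additive H) (.ofMul (f.onCell x))

theorem Cochain.eval_single (f : A.Cochain P H n) (x : A.NCell P n) :
    f.eval (.single x.1 1) = .ofMul (f x) := by
  simp [eval, onCell, x.2]

theorem ofMul_coboundary (f : A.Cochain P H n) (x : A.NCell P (n + 1)) :
    .ofMul (A.coboundary P H n f x) = f.eval (A.bd x.1) := rfl

theorem mem_cocycles_iff {f : A.Cochain P H n} :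
    f ∈ A.cocycles P H n ↔ ∀ x, P x → A.dim x = n + 1 → f.eval (A.bd x) = 0 :=
  funext_iff.trans ⟨fun h x hP hx => h ⟨x, hP, hx⟩, fun h x => h x.1 x.2.1 x.2.2⟩

end CellData

end Chains

section Cells

open Finsupp

variable {G : Type v} [Group G]

namespace B1

theorem dim_eq_length (l : List G) : (B1 G).dim l = l.length := by
  induction l with
  | nil => rfl
  | cons a l ih =>
    calc (B1 G).dim (a :: l) = 1 + (discrete G).dim a + (B1 G).dim l := CellData.bar_dim_cons a l
      _ = (a :: l).length := by rw [ih, List.length_cons]; exact add_comm 1 l.length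

theorem tupleBd_eq_zero (l : List G) : (discrete G).tupleBd l = 0 := by
  induction l with
  | nil => rfl
  | cons a l ih => simp [CellData.tupleBd, ih, show (discrete G).bd a = 0 from rfl]

theorem bd_eq_sum_face (l : List G) :
    (B1 G).bd l = ∑ k ∈ Finset.range (l.length + 1), (-1 : ℤ) ^ k • (discrete G).face k l :=
  calc (B1 G).bd l = _ + (-1 : ℤ) ^ l.length • (discrete G).tupleBd l := rfl
    _ = _ := by rw [tupleBd_eq_zero, smul_zero, add_zero]

theorem bd_one (a : G) : (B1 G).bd [a] = 0 := by
  simp [bd_eq_sum_face, Finset.sum_range_succ, CellData.face, discrete]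

theorem bd_two (a b : G) : (B1 G).bd [a, b] = single [b] 1 - single [a * b] 1 + single [a] 1 := by
  simp [bd_eq_sum_face, Finset.sum_range_succ, CellData.face, discrete, sub_eq_add_neg]

theorem bd_three (a b c : G) : (B1 G).bd [a, b, c] =
    single [b, c] 1 - single [a * b, c] 1 + single [a, b * c] 1 - single [a, b] 1 := by
  simp [bd_eq_sum_face, Finset.sum_range_succ, CellData.face, discrete, sub_eq_add_neg]

theorem bd_four (a b c d : G) : (B1 G).bd [a, b, c, d] =
    single [b, c, d] 1 - single [a * b, c, d] 1 + single [a, b * c, d] 1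
      - single [a, b, c * d] 1 + single [a, b, c] 1 := by
  simp [bd_eq_sum_face, Finset.sum_range_succ, CellData.face, discrete, sub_eq_add_neg]

theorem forall_dim_eq_four_iff {p : List G → Prop} :
    (∀ l, Nontriv1 l → (B1 G).dim l = 4 → p l) ↔ ∀ a b c d, p [a, b, c, d] := by
  refine ⟨fun h a b c d => h _ trivial rfl, fun h l _ hd => ?_⟩
  obtain ⟨a, b, c, d, rfl⟩ := List.length_eq_four.1 ((dim_eq_length l).symm.trans hd)
  exact h a b c d

theorem mul_eq_shuffle (l m : List G) : (B1 G).mul l m = (discrete G).shuffle l m := by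
  simp [B1, CellData.bar, CellData.barMul, CellData.tupleDim, discrete]

theorem mul_one_one (a b : G) : (B1 G).mul [a] [b] = single [a, b] 1 - single [b, a] 1 := by
  simp [mul_eq_shuffle, CellData.shuffle, discrete, sub_eq_add_neg]

theorem mul_one_two (a b c : G) : (B1 G).mul [a] [b, c] =
    single [a, b, c] 1 - single [b, a, c] 1 + single [b, c, a] 1 := by
  simp [mul_eq_shuffle, CellData.shuffle, discrete, mapDomain_add, ← single_neg, sub_eq_add_neg,
    add_assoc]

theorem mul_two_one (a b c : G) : (B1 G).mul [a, b] [c] =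
    single [a, b, c] 1 - single [a, c, b] 1 + single [c, a, b] 1 := by
  simp [mul_eq_shuffle, CellData.shuffle, discrete, mapDomain_add, ← single_neg, sub_eq_add_neg]

end B1

namespace B2

@[simp]
theorem dim_nil : (B2 G).dim [] = 0 := rfl

@[simp]
theorem dim_cons (l : List G) (L : List (List G)) :
    (B2 G).dim (l :: L) = 1 + l.length + (B2 G).dim L :=
  (CellData.bar_dim_cons l L).trans (by rw [B1.dim_eq_length]; rfl)

theorem bd_singleton {l : List G} (hl : l ≠ []) :
    (B2 G).bd [l] = -CellData.suspend ((B1 G).bd l) :=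
  CellData.bar_bd_singleton (by simpa [B1.dim_eq_length] using hl)

theorem bd_pair {l m : List G} (hl : l ≠ []) (hm : m ≠ []) :
    (B2 G).bd [l, m] = -CellData.suspend ((B1 G).mul l m)
      + (((B1 G).bd l).mapDomain (fun t => [t, m])
        + (-1 : ℤ) ^ l.length • ((B1 G).bd m).mapDomain fun t => [l, t]) := by
  rw [← B1.dim_eq_length l]
  exact CellData.bar_bd_pair (by simpa [B1.dim_eq_length] using hl)
    (by simpa [B1.dim_eq_length] using hm)

theorem bd_one_one (a b : G) : (B2 G).bd [[a], [b]] = single [[b, a]] 1 - single [[a, b]] 1 := by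
  simp [bd_pair, B1.mul_one_one, B1.bd_one]

theorem bd_one_two (a b c : G) : (B2 G).bd [[a], [b, c]] =
    -(single [[a, b, c]] 1 - single [[b, a, c]] 1 + single [[b, c, a]] 1)
      - (single [[a], [c]] 1 - single [[a], [b * c]] 1 + single [[a], [b]] 1) := by
  rw [bd_pair (by simp) (by simp), B1.mul_one_two, B1.bd_one, B1.bd_two]
  simp only [map_add, map_sub, CellData.suspend_single, mapDomain_zero, mapDomain_add,
    mapDomain_sub, mapDomain_single, List.length_singleton, pow_one, neg_smul, one_smul]
  abel

theorem bd_two_one (a b c : G) : (B2 G).bd [[a, b], [c]] =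
    -(single [[a, b, c]] 1 - single [[a, c, b]] 1 + single [[c, a, b]] 1)
      + (single [[b], [c]] 1 - single [[a * b], [c]] 1 + single [[a], [c]] 1) := by
  simp [bd_pair, B1.mul_two_one, B1.bd_one, B1.bd_two, mapDomain_add, mapDomain_sub,
    mapDomain_single]

theorem mul_one_one (a b : G) :
    (B2 G).mul [[a]] [[b]] = -(single [[a], [b]] 1 + single [[b], [a]] 1) := by
  simp [B2, CellData.bar_mul_singletons, B1.dim_eq_length, add_comm]

theorem cell_cases {L : List (List G)} (hL : Nontriv2 L) (hd : (B2 G).dim L < 6) :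
    L = [] ∨ (∃ l, L = [l]) ∨ ∃ l m, L = [l, m] ∧ 1 ≤ l.length ∧ 1 ≤ m.length := by
  have hpos : ∀ l ∈ L, 1 ≤ l.length := fun l hl => List.length_pos_iff.2 (hL l hl)
  have hdim : ∀ l ∈ L, 1 ≤ (B1 G).dim l := by simpa only [B1.dim_eq_length] using hpos
  refine (CellData.bar_cell_cases hdim hd).imp_right (.imp_right ?_)
  rintro ⟨l, m, rfl⟩
  exact ⟨l, m, rfl, hpos l (by simp), hpos m (by simp)⟩

theorem exists_eq_of_dim_eq_three {L : List (List G)} (hL : Nontriv2 L) (h : (B2 G).dim L = 3) :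
    ∃ a b, L = [[a, b]] := by
  rcases cell_cases hL (by omega) with rfl | ⟨l, rfl⟩ | ⟨l, m, rfl, hl, hm⟩ <;>
    simp only [dim_cons, dim_nil] at h
  · omega
  · obtain ⟨a, b, rfl⟩ := List.length_eq_two.1 (show l.length = 2 by omega)
    exact ⟨a, b, rfl⟩
  · omega

theorem exists_eq_of_dim_eq_four {L : List (List G)} (hL : Nontriv2 L) (h : (B2 G).dim L = 4) :
    (∃ a b c, L = [[a, b, c]]) ∨ ∃ a b, L = [[a], [b]] := by
  rcases cell_cases hL (by omega) with rfl | ⟨l, rfl⟩ | ⟨l, m, rfl, hl, hm⟩ <;>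
    simp only [dim_cons, dim_nil] at h
  · omega
  · obtain ⟨a, b, c, rfl⟩ := List.length_eq_three.1 (show l.length = 3 by omega)
    exact .inl ⟨a, b, c, rfl⟩
  · obtain ⟨a, rfl⟩ := List.length_eq_one_iff.1 (show l.length = 1 by omega)
    obtain ⟨b, rfl⟩ := List.length_eq_one_iff.1 (show m.length = 1 by omega)
    exact .inr ⟨a, b, rfl⟩

theorem forall_dim_eq_five_iff {p : List (List G) → Prop} :
    (∀ L, Nontriv2 L → (B2 G).dim L = 5 → p L) ↔
      (∀ a b c d, p [[a, b, c, d]]) ∧ (∀ a b c, p [[a], [b, c]]) ∧ ∀ a b c, p [[a, b], [c]] := by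
  refine ⟨fun h => ⟨?_, ?_, ?_⟩, fun h L hL hd => ?_⟩
  iterate 3 intros; exact h _ (by simp [Nontriv2]) (by simp)
  rcases cell_cases hL (by omega) with rfl | ⟨l, rfl⟩ | ⟨l, m, rfl, hl, hm⟩ <;>
    simp only [dim_cons, dim_nil] at hd
  · omega
  · obtain ⟨a, b, c, d, rfl⟩ := List.length_eq_four.1 (show l.length = 4 by omega)
    exact h.1 a b c d
  · obtain ⟨h1, h2⟩ | ⟨h2, h1⟩ :
        l.length = 1 ∧ m.length = 2 ∨ l.length = 2 ∧ m.length = 1 := by omega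
    · obtain ⟨a, rfl⟩ := List.length_eq_one_iff.1 h1
      obtain ⟨b, c, rfl⟩ := List.length_eq_two.1 h2
      exact h.2.1 a b c
    · obtain ⟨a, b, rfl⟩ := List.length_eq_two.1 h2
      obtain ⟨c, rfl⟩ := List.length_eq_one_iff.1 h1
      exact h.2.2 a b c

theorem two_le_dim {L : List (List G)} (hne : L ≠ []) (hL : Nontriv2 L) : 2 ≤ (B2 G).dim L := by
  obtain ⟨l, L, rfl⟩ := List.exists_cons_of_ne_nil hne
  have hl := List.length_pos_iff.2 (hL l (by simp))
  rw [dim_cons]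
  omega

theorem exists_eq_of_dim_eq_two {L : List (List G)} (hL : Nontriv2 L) (h : (B2 G).dim L = 2) :
    ∃ a, L = [[a]] := by
  rcases cell_cases hL (by omega) with rfl | ⟨l, rfl⟩ | ⟨l, m, rfl, hl, hm⟩ <;>
    simp only [dim_cons, dim_nil] at h
  · omega
  · obtain ⟨a, rfl⟩ := List.length_eq_one_iff.1 (show l.length = 1 by omega)
    exact ⟨a, rfl⟩
  · omega

end B2

namespace B3

@[simp]
theorem dim_nil : (B3 G).dim [] = 0 := rfl

@[simp]
theorem dim_cons (X : List (List G)) (L : List (List (List G))) :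
    (B3 G).dim (X :: L) = 1 + (B2 G).dim X + (B3 G).dim L :=
  CellData.bar_dim_cons X L

theorem bd_singleton {X : List (List G)} (hX : (B2 G).dim X ≠ 0) :
    (B3 G).bd [X] = -CellData.suspend ((B2 G).bd X) :=
  CellData.bar_bd_singleton hX

theorem bd_one_one (a b : G) :
    (B3 G).bd [[[a]], [[b]]] = single [[[a], [b]]] 1 + single [[[b], [a]]] 1 := by
  have hdim : ∀ c : G, (B2 G).dim [[c]] ≠ 0 := fun c => by simp
  have hbd : ∀ c : G, (B2 G).bd [[c]] = 0 := fun c => by simp [B2.bd_singleton, B1.bd_one]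
  rw [B3, CellData.bar_bd_pair (hdim a) (hdim b), B2.mul_one_one, hbd, hbd]
  simp [add_comm]

theorem cell_cases {L : List (List (List G))} (hL : Nontriv3 L) (hd : (B3 G).dim L < 7) :
    L = [] ∨ (∃ X, L = [X] ∧ Nontriv2 X) ∨ ∃ a b, L = [[[a]], [[b]]] := by
  have hdim : ∀ X ∈ L, 2 ≤ (B2 G).dim X := fun X hX => B2.two_le_dim (hL X hX).1 (hL X hX).2
  refine (CellData.bar_cell_cases hdim (hd.trans (by norm_num))).imp_right (.imp ?_ ?_)
  · rintro ⟨X, rfl⟩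
    exact ⟨X, rfl, (hL X (by simp)).2⟩
  · rintro ⟨X, Y, rfl⟩
    have hX := hdim X (by simp)
    have hY := hdim Y (by simp)
    simp only [dim_cons, dim_nil] at hd
    obtain ⟨a, rfl⟩ := B2.exists_eq_of_dim_eq_two (hL X (by simp)).2 (by omega)
    obtain ⟨b, rfl⟩ := B2.exists_eq_of_dim_eq_two (hL Y (by simp)).2 (by omega)
    exact ⟨a, b, rfl⟩

theorem exists_eq_of_dim_eq_five {L : List (List (List G))} (hL : Nontriv3 L)
    (h : (B3 G).dim L = 5) : (∃ a b c, L = [[[a, b, c]]]) ∨ ∃ a b, L = [[[a], [b]]] := by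
  rcases cell_cases hL (by omega) with rfl | ⟨X, rfl, hX⟩ | ⟨a, b, rfl⟩
  · simp at h
  · rw [dim_cons, dim_nil] at h
    rcases B2.exists_eq_of_dim_eq_four hX (by omega) with ⟨a, b, c, rfl⟩ | ⟨a, b, rfl⟩
    · exact .inl ⟨a, b, c, rfl⟩
    · exact .inr ⟨a, b, rfl⟩
  · simp at h

theorem forall_dim_eq_six_iff {p : List (List (List G)) → Prop} :
    (∀ L, Nontriv3 L → (B3 G).dim L = 6 → p L) ↔
      (∀ X, Nontriv2 X → (B2 G).dim X = 5 → p [X]) ∧ ∀ a b, p [[[a]], [[b]]] := by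
  refine ⟨fun h => ⟨fun X hX hd => ?_, fun a b => ?_⟩, fun h L hL hd => ?_⟩
  · have hne : X ≠ [] := by
      rintro rfl
      simp at hd
    exact h [X] (by simp [Nontriv3, hne, hX]) (by simp [hd])
  · exact h _ (by simp [Nontriv3, Nontriv2]) (by simp)
  · rcases cell_cases hL (by omega) with rfl | ⟨X, rfl, hX⟩ | ⟨a, b, rfl⟩
    · simp at hd
    · rw [dim_cons, dim_nil] at hd
      exact h.1 X hX (by omega)
    · exact h.2 a b

end B3

end Cells

section Cocycles

open CellData Finsupp

variable {G : Type v} [Group G] {H : Type u} [CommGroup H]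

namespace B1

theorem map_bd_four {e : (List G →₀ ℤ) →+ Additive H} {α : G → G → G → H}
    (hα : ∀ a b c, e (single [a, b, c] 1) = .ofMul (α a b c)) (a b c d : G) :
    e ((B1 G).bd [a, b, c, d]) = .ofMul
      (α a b c * α a (b * c) d * α b c d / (α (a * b) c d * α a b (c * d))) := by
  simp only [bd_four, map_add, map_sub, hα, ofMul_mul, ofMul_div]
  abel

theorem forall_map_bd_four_eq_zero_iff {e : (List G →₀ ℤ) →+ Additive H} {α : G → G → G → H}
    (hα : ∀ a b c, e (single [a, b, c] 1) = .ofMul (α a b c)) :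
    (∀ a b c d, e ((B1 G).bd [a, b, c, d]) = 0) ↔ PentagonScalars α := by
  simp only [map_bd_four hα, ofMul_eq_zero, div_eq_one, PentagonScalars]

variable (G H) in
/-- A `2`-cochain on `B_G` as a function on pairs. -/
def cochainTwoEquiv : (B1 G).Cochain Nontriv1 H 2 ≃ (G → G → H) where
  toFun f a b := f (cell1_2 a b)
  invFun μ x := match x.1 with
    | [a, b] => μ a b
    | _ => 1
  left_inv f := by
    funext ⟨l, _, hl⟩
    obtain ⟨a, b, rfl⟩ := List.length_eq_two.1 ((dim_eq_length l).symm.trans hl)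
    rfl
  right_inv _ := rfl

variable (G H) in
/-- A `3`-cochain on `B_G` as a function on triples. -/
def cochainThreeEquiv : (B1 G).Cochain Nontriv1 H 3 ≃* (G → G → G → H) where
  toFun f a b c := f (cell1_3 a b c)
  invFun α x := match x.1 with
    | [a, b, c] => α a b c
    | _ => 1
  left_inv f := by
    funext ⟨l, _, hl⟩
    obtain ⟨a, b, c, rfl⟩ := List.length_eq_three.1 ((dim_eq_length l).symm.trans hl)
    rfl
  right_inv _ := rfl
  map_mul' _ _ := rfl

theorem cochainThreeEquiv_coboundary (μ : (B1 G).Cochain Nontriv1 H 2) :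
    cochainThreeEquiv G H ((B1 G).coboundary Nontriv1 H 2 μ) =
      assocChange (cochainTwoEquiv G H μ) := by
  funext a b c
  have hμ : ∀ a b, μ.eval (single [a, b] 1) = .ofMul (cochainTwoEquiv G H μ a b) :=
    fun a b => μ.eval_single (cell1_2 a b)
  apply Additive.ofMul.injective
  calc _ = μ.eval ((B1 G).bd [a, b, c]) := ofMul_coboundary μ (cell1_3 a b c)
    _ = _ := by
      simp only [bd_three, map_add, map_sub, hμ, assocChange, ofMul_mul, ofMul_div]
      abel

theorem mem_cocycles_iff_pentagonScalars {f : (B1 G).Cochain Nontriv1 H 3} :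
    f ∈ (B1 G).cocycles Nontriv1 H 3 ↔ PentagonScalars (cochainThreeEquiv G H f) :=
  (mem_cocycles_iff.trans forall_dim_eq_four_iff).trans
    (forall_map_bd_four_eq_zero_iff fun a b c => f.eval_single (cell1_3 a b c))

variable (G H) in
/-- A `3`-cocycle on `B_G` as the scalars of an associativity structure. -/
def cocycleEquiv :
    (B1 G).cocycles Nontriv1 H 3 ≃ {α : G → G → G → H // PentagonScalars α} :=
  (cochainThreeEquiv G H).toEquiv.subtypeEquiv fun _ => mem_cocycles_iff_pentagonScalars

theorem coboundaries_le_cocycles :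
    (B1 G).coboundaries Nontriv1 H 2 ≤ (B1 G).cocycles Nontriv1 H 3 := by
  rintro _ ⟨μ, rfl⟩
  rw [mem_cocycles_iff_pentagonScalars, cochainThreeEquiv_coboundary]
  exact pentagonScalars_assocChange _

theorem eq_mul_coboundary_iff {z z' : (B1 G).Cochain Nontriv1 H 3}
    {μ : (B1 G).Cochain Nontriv1 H 2} :
    z' = z * (B1 G).coboundary Nontriv1 H 2 μ ↔
      cochainThreeEquiv G H z' = cochainThreeEquiv G H z * assocChange (cochainTwoEquiv G H μ) := by
  rw [← (cochainThreeEquiv G H).injective.eq_iff, map_mul, cochainThreeEquiv_coboundary]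

end B1

namespace B2

section

variable {e : (List (List G) →₀ ℤ) →+ Additive H} {α : G → G → G → H} {τ : G → G → H}

theorem forall_map_bd_four_eq_zero_iff
    (hα : ∀ a b c, e (single [[a, b, c]] 1) = .ofMul (α a b c)) :
    (∀ a b c d, e ((B2 G).bd [[a, b, c, d]]) = 0) ↔ PentagonScalars α := by
  rw [← B1.forall_map_bd_four_eq_zero_iff (e := e.comp suspend)
    fun a b c => (congrArg e (suspend_single _ _)).trans (hα a b c)]
  simp [bd_singleton]

theorem map_bd_one_two (hα : ∀ a b c, e (single [[a, b, c]] 1) = .ofMul (α a b c))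
    (hτ : ∀ a b, e (single [[a], [b]] 1) = .ofMul (τ a b)⁻¹) (a b c : G) :
    e ((B2 G).bd [[a], [b, c]]) = .ofMul
      (τ a b * α b a c * τ a c / (α a b c * τ a (b * c) * α b c a)) := by
  simp only [bd_one_two, map_add, map_sub, map_neg, hα, hτ, ofMul_mul, ofMul_div, ofMul_inv]
  abel

theorem map_bd_two_one (hα : ∀ a b c, e (single [[a, b, c]] 1) = .ofMul (α a b c))
    (hτ : ∀ a b, e (single [[a], [b]] 1) = .ofMul (τ a b)⁻¹) (a b c : G) :
    e ((B2 G).bd [[a, b], [c]]) = .ofMul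
      ((τ a c)⁻¹ * α a c b * (τ b c)⁻¹ / (α c a b * (τ (a * b) c)⁻¹ * α a b c)) := by
  simp only [bd_two_one, map_add, map_sub, map_neg, hα, hτ, ofMul_mul, ofMul_div, ofMul_inv]
  abel

theorem forall_map_bd_one_two_eq_zero_iff
    (hα : ∀ a b c, e (single [[a, b, c]] 1) = .ofMul (α a b c))
    (hτ : ∀ a b, e (single [[a], [b]] 1) = .ofMul (τ a b)⁻¹) :
    (∀ a b c, e ((B2 G).bd [[a], [b, c]]) = 0) ↔ HexagonScalars α τ := by
  simp only [map_bd_one_two hα hτ, ofMul_eq_zero, div_eq_one, HexagonScalars]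
  exact forall₃_congr fun _ _ _ => eq_comm

theorem forall_map_bd_two_one_eq_zero_iff
    (hα : ∀ a b c, e (single [[a, b, c]] 1) = .ofMul (α a b c))
    (hτ : ∀ a b, e (single [[a], [b]] 1) = .ofMul (τ a b)⁻¹) :
    (∀ a b c, e ((B2 G).bd [[a, b], [c]]) = 0) ↔ HexagonScalars α fun a b => (τ b a)⁻¹ := by
  simp only [map_bd_two_one hα hτ, ofMul_eq_zero, div_eq_one, HexagonScalars]
  exact ⟨fun h c a b => (h a b c).symm, fun h a b c => (h c a b).symm⟩

theorem forall_map_bd_eq_zero_iff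
    (hα : ∀ a b c, e (single [[a, b, c]] 1) = .ofMul (α a b c))
    (hτ : ∀ a b, e (single [[a], [b]] 1) = .ofMul (τ a b)⁻¹) :
    (∀ L, Nontriv2 L → (B2 G).dim L = 5 → e ((B2 G).bd L) = 0) ↔ BraidedScalars α τ := by
  rw [forall_dim_eq_five_iff, forall_map_bd_four_eq_zero_iff hα,
    forall_map_bd_one_two_eq_zero_iff hα hτ, forall_map_bd_two_one_eq_zero_iff hα hτ]
  exact ⟨fun h => ⟨h.1, h.2.1, h.2.2⟩, fun h => ⟨h.pentagon, h.hexagon, h.hexagon_inv⟩⟩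

end

variable (G H) in
/-- A `3`-cochain on `B²_G` as the function on pairs that takes the inverses of its values. -/
def cochainThreeEquiv : (B2 G).Cochain Nontriv2 H 3 ≃ (G → G → H) where
  toFun f a b := (f (cell2_2 a b))⁻¹
  invFun μ x := match x.1 with
    | [[a, b]] => (μ a b)⁻¹
    | _ => 1
  left_inv f := by
    funext ⟨L, hL, hd⟩
    obtain ⟨a, b, rfl⟩ := exists_eq_of_dim_eq_three hL hd
    exact inv_inv _
  right_inv _ := funext₂ fun _ _ => inv_inv _

variable (G H) in
/-- A `4`-cochain `(α, σ)` on `B²_G` as the pair of functions `(α, σ⁻¹)`. -/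
def cochainFourEquiv : (B2 G).Cochain Nontriv2 H 4 ≃* (G → G → G → H) × (G → G → H) where
  toFun f := (fun a b c => f (cell2_3 a b c), fun a b => (f (cell2_11 a b))⁻¹)
  invFun p x := match x.1 with
    | [[a, b, c]] => p.1 a b c
    | [[a], [b]] => (p.2 a b)⁻¹
    | _ => 1
  left_inv f := by
    funext ⟨L, hL, hd⟩
    obtain ⟨a, b, c, rfl⟩ | ⟨a, b, rfl⟩ := exists_eq_of_dim_eq_four hL hd
    · rfl
    · exact inv_inv _
  right_inv _ := Prod.ext rfl (funext₂ fun _ _ => inv_inv _)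
  map_mul' _ _ := Prod.ext rfl (funext₂ fun _ _ => mul_inv _ _)

theorem cochainFourEquiv_coboundary (μ : (B2 G).Cochain Nontriv2 H 3) :
    cochainFourEquiv G H ((B2 G).coboundary Nontriv2 H 3 μ) =
      (assocChange (cochainThreeEquiv G H μ), commChange (cochainThreeEquiv G H μ)) := by
  have hμ : ∀ a b, μ.eval (single [[a, b]] 1) = -.ofMul (cochainThreeEquiv G H μ a b) :=
    fun a b => (μ.eval_single (cell2_2 a b)).trans (neg_neg _).symm
  refine Prod.ext (funext₃ fun a b c => Additive.ofMul.injective ?_)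
    (funext₂ fun a b => Additive.ofMul.injective ?_)
  · calc _ = μ.eval ((B2 G).bd [[a, b, c]]) := ofMul_coboundary μ (cell2_3 a b c)
      _ = _ := by
        simp only [bd_singleton (List.cons_ne_nil _ _), B1.bd_three, map_add, map_sub, map_neg,
          suspend_single, hμ, assocChange, ofMul_mul, ofMul_div]
        abel
  · calc _ = -μ.eval ((B2 G).bd [[a], [b]]) := congrArg Neg.neg (ofMul_coboundary μ (cell2_11 a b))
      _ = _ := by
        simp only [bd_one_one, map_sub, hμ, commChange, ofMul_div]
        abel

theorem mem_cocycles_iff_braidedScalars {f : (B2 G).Cochain Nontriv2 H 4} :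
    f ∈ (B2 G).cocycles Nontriv2 H 4 ↔
      BraidedScalars (cochainFourEquiv G H f).1 (cochainFourEquiv G H f).2 :=
  mem_cocycles_iff.trans <| forall_map_bd_eq_zero_iff
    (fun a b c => f.eval_single (cell2_3 a b c))
    fun a b => (f.eval_single (cell2_11 a b)).trans (neg_neg _).symm

variable (G H) in
/-- A `4`-cocycle on `B²_G` as the scalars of a braided structure. -/
def cocycleEquiv : (B2 G).cocycles Nontriv2 H 4 ≃
    {p : (G → G → G → H) × (G → G → H) // BraidedScalars p.1 p.2} :=
  (cochainFourEquiv G H).toEquiv.subtypeEquiv fun _ => mem_cocycles_iff_braidedScalars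

theorem coboundaries_le_cocycles (hG : ∀ a b : G, a * b = b * a) :
    (B2 G).coboundaries Nontriv2 H 3 ≤ (B2 G).cocycles Nontriv2 H 4 := by
  rintro _ ⟨μ, rfl⟩
  rw [mem_cocycles_iff_braidedScalars, cochainFourEquiv_coboundary]
  exact braidedScalars_change hG _

theorem eq_mul_coboundary_iff {z z' : (B2 G).Cochain Nontriv2 H 4}
    {μ : (B2 G).Cochain Nontriv2 H 3} :
    z' = z * (B2 G).coboundary Nontriv2 H 3 μ ↔
      (cochainFourEquiv G H z').1 =
          (cochainFourEquiv G H z).1 * assocChange (cochainThreeEquiv G H μ) ∧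
        (cochainFourEquiv G H z').2 =
          (cochainFourEquiv G H z).2 * commChange (cochainThreeEquiv G H μ) := by
  rw [← (cochainFourEquiv G H).injective.eq_iff, map_mul, cochainFourEquiv_coboundary, Prod.ext_iff]
  rfl

end B2

namespace B3

variable (G H) in
/-- A `5`-cochain `(α, σ)` on `B³_G` as the pair of functions `(α, σ⁻¹)`. -/
def cochainFiveEquiv : (B3 G).Cochain Nontriv3 H 5 ≃ (G → G → G → H) × (G → G → H) where
  toFun f := (fun a b c => f (cell3_3 a b c), fun a b => (f (cell3_11 a b))⁻¹)
  invFun p x := match x.1 with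
    | [[[a, b, c]]] => p.1 a b c
    | [[[a], [b]]] => (p.2 a b)⁻¹
    | _ => 1
  left_inv f := by
    funext ⟨L, hL, hd⟩
    obtain ⟨a, b, c, rfl⟩ | ⟨a, b, rfl⟩ := exists_eq_of_dim_eq_five hL hd
    · rfl
    · exact inv_inv _
  right_inv _ := Prod.ext rfl (funext₂ fun _ _ => inv_inv _)

theorem mem_cocycles_iff_braidedScalars {f : (B3 G).Cochain Nontriv3 H 5} :
    f ∈ (B3 G).cocycles Nontriv3 H 5 ↔
      BraidedScalars (cochainFiveEquiv G H f).1 (cochainFiveEquiv G H f).2 ∧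
        ∀ a b, (cochainFiveEquiv G H f).2 a b * (cochainFiveEquiv G H f).2 b a = 1 := by
  have hα : ∀ a b c, (f.eval.comp suspend) (single [[a, b, c]] 1) =
      .ofMul ((cochainFiveEquiv G H f).1 a b c) :=
    fun a b c => (congrArg f.eval (suspend_single _ _)).trans (f.eval_single (cell3_3 a b c))
  have hτ : ∀ a b, f.eval (single [[[a], [b]]] 1) =
      .ofMul ((cochainFiveEquiv G H f).2 a b)⁻¹ :=
    fun a b => (f.eval_single (cell3_11 a b)).trans (neg_neg _).symm
  have hτ' : ∀ a b, (f.eval.comp suspend) (single [[a], [b]] 1) =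
      .ofMul ((cochainFiveEquiv G H f).2 a b)⁻¹ :=
    fun a b => (congrArg f.eval (suspend_single _ _)).trans (hτ a b)
  rw [mem_cocycles_iff, forall_dim_eq_six_iff, ← B2.forall_map_bd_eq_zero_iff hα hτ']
  refine and_congr (forall₃_congr fun X _ hX => ?_) (forall₂_congr fun a b => ?_)
  · rw [bd_singleton (by omega), map_neg, neg_eq_zero]
    rfl
  · rw [bd_one_one, map_add, hτ, hτ, ← ofMul_mul, ofMul_eq_zero, ← mul_inv, inv_eq_one]

variable (G H) in
/-- A `5`-cocycle on `B³_G` as the scalars of a symmetric structure. -/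
def cocycleEquiv : (B3 G).cocycles Nontriv3 H 5 ≃ {p : (G → G → G → H) × (G → G → H) //
    BraidedScalars p.1 p.2 ∧ ∀ a b, p.2 a b * p.2 b a = 1} :=
  (cochainFiveEquiv G H).subtypeEquiv fun _ => mem_cocycles_iff_braidedScalars

end B3

end Cocycles

end

end GroupCat

theorem mainTheorem10 (R : Type u) [CommRing R] (G : Type v) [Group G] :
    -- every associativity structure extends to a monoidal structure
    (∀ A : GroupCat.AssocStr R G, Nonempty (GroupCat.UnitStr A)) ∧
    -- (1) 3-cocycles on `B_G` are associativity structures, and 2-cochains are self-transformations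
    ((GroupCat.B1 G).coboundaries GroupCat.Nontriv1 Rˣ 2
        ≤ (GroupCat.B1 G).cocycles GroupCat.Nontriv1 Rˣ 3 ∧
      ∃ (Φ : (GroupCat.B1 G).cocycles GroupCat.Nontriv1 Rˣ 3 ≃ GroupCat.AssocStr R G)
        (Ψ : (GroupCat.B1 G).Cochain GroupCat.Nontriv1 Rˣ 2 ≃ GroupCat.ProductAut R G),
        (∀ z, (Φ z).HasScalars fun a b c => z.1 (GroupCat.cell1_3 a b c)) ∧
        (∀ μ, (Ψ μ).HasScalars fun a b => μ (GroupCat.cell1_2 a b)) ∧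
        ∀ μ z z', z'.1 = z.1 * (GroupCat.B1 G).coboundary GroupCat.Nontriv1 Rˣ 2 μ ↔
          (Ψ μ).CarriesAssoc (Φ z) (Φ z')) ∧
    ((∀ a b : G, a * b = b * a) →
      -- (2) 4-cocycles on `B²_G` are braided structures, and 3-cochains are self-transformations
      ((GroupCat.B2 G).coboundaries GroupCat.Nontriv2 Rˣ 3
          ≤ (GroupCat.B2 G).cocycles GroupCat.Nontriv2 Rˣ 4 ∧
        ∃ (Φ : (GroupCat.B2 G).cocycles GroupCat.Nontriv2 Rˣ 4 ≃ GroupCat.BraidedStr R G)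
          (Ψ : (GroupCat.B2 G).Cochain GroupCat.Nontriv2 Rˣ 3 ≃ GroupCat.ProductAut R G),
          (∀ z, (Φ z).toAssocStr.HasScalars (fun a b c => z.1 (GroupCat.cell2_3 a b c)) ∧
            (Φ z).CommHasScalars fun a b => (z.1 (GroupCat.cell2_11 a b))⁻¹) ∧
          (∀ μ, (Ψ μ).HasScalars fun a b => (μ (GroupCat.cell2_2 a b))⁻¹) ∧
          ∀ μ z z', z'.1 = z.1 * (GroupCat.B2 G).coboundary GroupCat.Nontriv2 Rˣ 3 μ ↔
            (Ψ μ).CarriesBraided (Φ z) (Φ z')) ∧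
      -- (3) 5-cocycles on `B³_G` are symmetric structures
      ∃ Φ : (GroupCat.B3 G).cocycles GroupCat.Nontriv3 Rˣ 5 ≃ GroupCat.SymmetricStr R G,
        ∀ z, (Φ z).toAssocStr.HasScalars (fun a b c => z.1 (GroupCat.cell3_3 a b c)) ∧
          (Φ z).toBraidedStr.CommHasScalars fun a b => (z.1 (GroupCat.cell3_11 a b))⁻¹) := by
  refine ⟨GroupCat.nonempty_unitStr, ⟨GroupCat.B1.coboundaries_le_cocycles,
    (GroupCat.B1.cocycleEquiv G Rˣ).trans (GroupCat.AssocStr.equivScalars R G),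
    (GroupCat.B1.cochainTwoEquiv G Rˣ).trans (GroupCat.ProductAut.equivScalars R G),
    fun z => GroupCat.AssocStr.equivScalars_hasScalars _,
    fun μ => GroupCat.ProductAut.equivScalars_hasScalars _, fun μ z z' => ?_⟩,
    fun hG => ⟨⟨GroupCat.B2.coboundaries_le_cocycles hG,
      (GroupCat.B2.cocycleEquiv G Rˣ).trans (GroupCat.BraidedStr.equivScalars R hG),
      (GroupCat.B2.cochainThreeEquiv G Rˣ).trans (GroupCat.ProductAut.equivScalars R G),
      fun z => GroupCat.BraidedStr.equivScalars_hasScalars hG _,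
      fun μ => GroupCat.ProductAut.equivScalars_hasScalars _, fun μ z z' => ?_⟩,
      (GroupCat.B3.cocycleEquiv G Rˣ).trans (GroupCat.SymmetricStr.equivScalars R hG),
      fun z => GroupCat.SymmetricStr.equivScalars_hasScalars hG _⟩⟩
  · exact GroupCat.B1.eq_mul_coboundary_iff.trans (GroupCat.ProductAut.carriesAssoc_iff
      (GroupCat.ProductAut.equivScalars_hasScalars _)
      (GroupCat.AssocStr.equivScalars_hasScalars (GroupCat.B1.cocycleEquiv G Rˣ z))
      (GroupCat.AssocStr.equivScalars_hasScalars (GroupCat.B1.cocycleEquiv G Rˣ z'))).symm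
  · have hz := GroupCat.BraidedStr.equivScalars_hasScalars hG (GroupCat.B2.cocycleEquiv G Rˣ z)
    have hz' := GroupCat.BraidedStr.equivScalars_hasScalars hG (GroupCat.B2.cocycleEquiv G Rˣ z')
    exact GroupCat.B2.eq_mul_coboundary_iff.trans (GroupCat.ProductAut.carriesBraided_iff
      (GroupCat.ProductAut.equivScalars_hasScalars _) hz.1 hz.2 hz'.1 hz'.2).symm
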